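/- Let $m>3$ and let $\mathbf R$ be a real $m\times 3$ matrix with $\mathbf R^{T}k\neq 0$ for all $k\in\mathbb Z^m\setminus\{0\}$. Let $\Omega\subset\mathbb R^3$ be open and bounded (for instance with Lipschitz boundary), and let $Y^m={]0,1[}^m$; the subscript $\sharp$ denotes $Y^m$-periodicity. *Definitions.* $H(\mathrm{curl},\Omega)$ is the space of $v\in L^2(\Omega;\mathbb R^3)$ whose distributional curl is in $L^2(\Omega;\mathbb R^3)$. For $\eta_k\to0$, $\eta_k>0$, a sequence $v_{k}$ two-scale converges weakly to $v_0\in L^2(\Omega\times Y^m)$ if $$\int_\Omega v_{k}(x)\,\varphi\Big(x,\frac{\mathbf Rx}{\eta_k}\Big)\,dx\to\iint_{\Omega\times Y^m}v_0(x,y)\,\varphi(x,y)\,dx\,dy\qquad\text{for all }\varphi\in L^2(\Omega;C_\sharp(Y^m)),$$ componentwise for vector fields. The operators $\mathrm{grad}_{\mathbf R}=\mathbf R^{T}\nabla_y$ and $\mathrm{curl}_{\mathbf R}=(\mathbf R^{T}\nabla_y)\times$ act term by term on formal Fourier series in $y$: if $\phi=\sum_k\phi_k e^{2\pi i k\cdot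 y}$ and $v=\sum_k v_ke^{2\pi ik\cdot y}$, then $$\mathrm{grad}_{\mathbf R}\phi=\sum_k2\pi i\,\phi_k\,\mathbf R^{T}k\,e^{2\pi ik\cdot y},\qquad \mathrm{curl}_{\mathbf R}v=\sum_k2\pi i\,\mathbf R^{T}k\times v_k\,e^{2\pi ik\cdot y}.$$ The potentials $\phi(x,\cdot)$ and $u_1(x,\cdot)$ below are real-valued formal Fourier series (the coefficient of index $-k$ is the complex conjugate of that of index $k$) with coefficients measurable in $x$, which need not be square summable. Let $X$ be the Hilbert space of $w\in L^2_\sharp(Y^m;\mathbb R^3)$ with $\mathrm{curl}_{\mathbf R}w=0$. Then $H(\mathrm{curl},\Omega;X)$ is the space of $v\in L^2(\Omega;X)$ whose curl in $x$, as an $X$-valued distribution, is in $L^2(\Omega;X)$; that is, there is $c\in L^2(\Omega;X)$ with $$\iint_{\Omega\times Y^m} v\cdot(\nabla\psi(x)\times g(y))\,dx\,dy=\iint_{\Omega\times Y^m} c\cdot\psi(x)g(y)\,dx\,dy\qquad\text{for all }\psi\in C_c^\infty(\Omega),\ g\in X.$$ *Statement.* Let $\eta_j>0$, $\eta_j\to0$,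 and let $(u_{\eta_j})$ be a bounded sequence in $H(\mathrm{curl},\Omega)$. Then there are a subsequence $(\eta_{j_k})$ and $u_0\in H(\mathrm{curl},\Omega;X)$, $\mathrm{grad}_{\mathbf R}\phi\in L^2(\Omega;L^2_\sharp(Y^m;\mathbb R^3))$, $\mathrm{curl}_{\mathbf R}u_1\in L^2(\Omega;L^2_\sharp(Y^m;\mathbb R^3))$ such that the average $u(x)=\int_{Y^m}u_0(x,y)\,dy$ belongs to $H(\mathrm{curl},\Omega)$, and, as $k\to\infty$, with weak two-scale convergence for $\mathbf R$, $$u_{\eta_{j_k}}\rightharpoonup u_0(x,y)=u(x)+\mathrm{grad}_{\mathbf R}\phi(x,y),\qquad \mathrm{curl}\,u_{\eta_{j_k}}\rightharpoonup\mathrm{curl}\,u(x)+\mathrm{curl}_{\mathbf R}u_1(x,y).$$ -/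

import Mathlib

open MeasureTheory Filter Topology
open scoped Matrix ContDiff

noncomputable section

namespace QuasiTwoScale

/-- Three-dimensional Euclidean space. -/
abbrev E3 : Type := EuclideanSpace ℝ (Fin 3)

/-- The torus `ℝ^m / ℤ^m`; functions on it are the `Y^m`-periodic functions, `Y^m = ]0,1[^m`. -/
abbrev T (m : ℕ) : Type := UnitAddTorus (Fin m)

/-- Lebesgue measure on the unit cell `Y^m`, transported to the torus (total mass one). -/
abbrev cellMeasure (m : ℕ) : Measure (T m) :=
  Measure.pi fun _ : Fin m => (AddCircle.haarAddCircle : Measure UnitAddCircle)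

/-- The product measure `dx dy` on `Ω × Y^m`. -/
abbrev prodMeasure (Ω : Set E3) (m : ℕ) : Measure (E3 × T m) :=
  (volume.restrict Ω).prod (cellMeasure m)

/-- Class of a point of `ℝ^m` modulo `ℤ^m`. -/
def toTorus {m : ℕ} (y : Fin m → ℝ) : T m := fun j => (y j : UnitAddCircle)

/-- The irrationality criterion: `Rᵀ k ≠ 0` for every nonzero integer vector `k`. -/
def Irrational {m : ℕ} (R : Matrix (Fin m) (Fin 3) ℝ) : Prop :=
  ∀ k : Fin m → ℤ, k ≠ 0 → Rᵀ *ᵥ (fun j => (k j : ℝ)) ≠ 0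

/-! ### The space `H(curl, Ω)` -/

/-- Cross product on `E3`. -/
def cross (a b : E3) : E3 := WithLp.toLp 2 (crossProduct a.ofLp b.ofLp)

/-- The partial derivative `∂ᵢ ψⱼ` at `x`. -/
def pd (i j : Fin 3) (ψ : E3 → E3) (x : E3) : ℝ :=
  fderiv ℝ ψ x (EuclideanSpace.single i 1) j

/-- The classical curl of a differentiable vector field. -/
def curl (ψ : E3 → E3) (x : E3) : E3 :=
  !₂[pd 1 2 ψ x - pd 2 1 ψ x, pd 2 0 ψ x - pd 0 2 ψ x, pd 0 1 ψ x - pd 1 0 ψ x]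

/-- Smooth functions with compact support in `Ω`. -/
def IsTest {F : Type*} [NormedAddCommGroup F] [NormedSpace ℝ F] (Ω : Set E3) (ψ : E3 → F) : Prop :=
  ContDiff ℝ ∞ ψ ∧ HasCompactSupport ψ ∧ tsupport ψ ⊆ Ω

/-- `u ∈ H(curl, Ω)` with distributional curl `c`: both are in `L²(Ω; ℝ³)`, and
`∫ u · curl ψ = ∫ c · ψ` for every test field `ψ`. -/
structure HasWeakCurl (Ω : Set E3) (u c : E3 → E3) : Prop where
  memLp : MemLp u 2 (volume.restrict Ω)
  memLp_curl : MemLp c 2 (volume.restrict Ω)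
  integral_eq : ∀ ψ : E3 → E3, IsTest Ω ψ →
    ∫ x in Ω, inner ℝ (u x) (curl ψ x) = ∫ x in Ω, inner ℝ (c x) (ψ x)

/-! ### Weak two-scale cut-and-projection convergence -/

/-- Weak two-scale convergence of the scalar functions `u j` to `u₀ ∈ L²(Ω × Y^m)` for the matrix
`R`, along the scales `η j`; the test functions are those of `L²(Ω; C_♯(Y^m))`. -/
def WeakTwoScale {m : ℕ} (Ω : Set E3) (R : Matrix (Fin m) (Fin 3) ℝ) (η : ℕ → ℝ)
    (u : ℕ → E3 → ℝ) (u₀ : E3 × T m → ℝ) : Prop :=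
  MemLp u₀ 2 (prodMeasure Ω m) ∧
  ∀ φ : E3 → C(T m, ℝ), MemLp φ 2 (volume.restrict Ω) →
    Tendsto (fun j => ∫ x in Ω, u j x * φ x (toTorus ((η j)⁻¹ • (R *ᵥ x.ofLp)))) atTop
      (𝓝 (∫ z, u₀ z * φ z.1 z.2 ∂(prodMeasure Ω m)))

/-- Weak two-scale convergence of vector fields, component by component. -/
def WeakTwoScaleVec {m : ℕ} (Ω : Set E3) (R : Matrix (Fin m) (Fin 3) ℝ) (η : ℕ → ℝ)
    (u : ℕ → E3 → E3) (u₀ : E3 × T m → E3) : Prop :=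
  ∀ i : Fin 3, WeakTwoScale Ω R η (fun j x => u j x i) (fun z => u₀ z i)

/-! ### The operators `grad_R` and `curl_R`

They are `Rᵀ∇_y` and `(Rᵀ∇_y) ×`, acting term by term on Fourier series
`∑ₖ a_k exp(2πi k·y)`.  For `L²` functions this is the periodic distributional derivative.
Potentials are arbitrary formal Fourier series: `grad_R φ` may be in `L²` although the
coefficients of `φ` are not square summable. -/

/-- `k`-th Fourier coefficient (in `ℂ³`) of a real vector field on the torus. -/
def coeff {m : ℕ} (w : T m → E3) (k : Fin m → ℤ) : Fin 3 → ℂ :=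
  fun i => UnitAddTorus.mFourierCoeff (fun y => ((w y i : ℝ) : ℂ)) k

/-- The vector `Rᵀ k`, seen in `ℂ³`. -/
def freq {m : ℕ} (R : Matrix (Fin m) (Fin 3) ℝ) (k : Fin m → ℤ) : Fin 3 → ℂ :=
  fun i => (((Rᵀ *ᵥ (fun j => (k j : ℝ))) i : ℝ) : ℂ)

/-- `w = grad_R φ` on the torus: `ŵ(k) = 2πi φ_k Rᵀk` for every `k`. -/
def HasGradR {m : ℕ} (R : Matrix (Fin m) (Fin 3) ℝ) (φ : (Fin m → ℤ) → ℂ) (w : T m → E3) : Prop :=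
  ∀ k, coeff w k = (2 * Real.pi * Complex.I * φ k) • freq R k

/-- `w = curl_R v` on the torus: `ŵ(k) = 2πi Rᵀk × v_k` for every `k`. -/
def HasCurlR {m : ℕ} (R : Matrix (Fin m) (Fin 3) ℝ) (v : (Fin m → ℤ) → Fin 3 → ℂ)
    (w : T m → E3) : Prop :=
  ∀ k, coeff w k = (2 * Real.pi * Complex.I : ℂ) • crossProduct (freq R k) (v k)

/-- The space of `curl_R`-free fields in `L²_♯(Y^m; ℝ³)`. -/
def CurlRFree {m : ℕ} (R : Matrix (Fin m) (Fin 3) ℝ) (w : T m → E3) : Prop :=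
  MemLp w 2 (cellMeasure m) ∧ HasCurlR R (coeff w) 0

/-- `g = grad_R φ` in `L²(Ω; L²_♯(Y^m; ℝ³))`, where `φ(x, ·)` is a real-valued formal Fourier series
(`φ_{-k}` is the conjugate of `φ_k`) whose coefficients `φ_k(x)` are measurable in `x`. -/
structure IsGradRField {m : ℕ} (Ω : Set E3) (R : Matrix (Fin m) (Fin 3) ℝ)
    (φ : E3 → (Fin m → ℤ) → ℂ) (g : E3 × T m → E3) : Prop where
  memLp : MemLp g 2 (prodMeasure Ω m)
  measurable_coeff : ∀ k, AEStronglyMeasurable (fun x => φ x k) (volume.restrict Ω)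
  real : ∀ᵐ x ∂(volume.restrict Ω), ∀ k, φ x (-k) = star (φ x k)
  grad_eq : ∀ᵐ x ∂(volume.restrict Ω), HasGradR R (φ x) (fun y => g (x, y))

/-- `w = curl_R u₁` in `L²(Ω; L²_♯(Y^m; ℝ³))`, where `u₁(x, ·)` is a real-valued formal Fourier series
whose coefficients are measurable in `x`. -/
structure IsCurlRField {m : ℕ} (Ω : Set E3) (R : Matrix (Fin m) (Fin 3) ℝ)
    (u₁ : E3 → (Fin m → ℤ) → Fin 3 → ℂ) (w : E3 × T m → E3) : Prop where
  memLp : MemLp w 2 (prodMeasure Ω m)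
  measurable_coeff : ∀ k, AEStronglyMeasurable (fun x => u₁ x k) (volume.restrict Ω)
  real : ∀ᵐ x ∂(volume.restrict Ω), ∀ k, u₁ x (-k) = star (u₁ x k)
  curl_eq : ∀ᵐ x ∂(volume.restrict Ω), HasCurlR R (u₁ x) (fun y => w (x, y))

/-- `v ∈ L²(Ω; X)` for `X` the space of `curl_R`-free fields. -/
def MemL2CurlRFree {m : ℕ} (Ω : Set E3) (R : Matrix (Fin m) (Fin 3) ℝ) (v : E3 × T m → E3) : Prop :=
  MemLp v 2 (prodMeasure Ω m) ∧ ∀ᵐ x ∂(volume.restrict Ω), CurlRFree R (fun y => v (x, y))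

/-- The space `H(curl, Ω; X)`, `X` the Hilbert space of `curl_R`-free fields: `v ∈ L²(Ω; X)`, and the
curl of `v` in `x`, as an `X`-valued distribution on `Ω`, is a function `c ∈ L²(Ω; X)`.  The pairing
in `X` is the one of `L²(Y^m; ℝ³)`, so the test fields are `ψ(x) g(y)`, with `g ∈ X`, and
`curl_x (ψ g) = ∇ψ × g`. -/
def MemHcurlX {m : ℕ} (Ω : Set E3) (R : Matrix (Fin m) (Fin 3) ℝ) (v : E3 × T m → E3) : Prop :=
  MemL2CurlRFree Ω R v ∧ ∃ c : E3 × T m → E3, MemL2CurlRFree Ω R c ∧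
    ∀ (ψ : E3 → ℝ) (g : T m → E3), IsTest Ω ψ → CurlRFree R g →
      ∫ z, inner ℝ (v z) (cross (gradient ψ z.1) (g z.2)) ∂(prodMeasure Ω m) =
        ∫ z, inner ℝ (c z) (ψ z.1 • g z.2) ∂(prodMeasure Ω m)

end QuasiTwoScale

end

/-!
The two limits come from weak compactness, and their structure from testing against oscillating
fields.

*Compactness.* Since `Rᵀk ≠ 0` for `k ≠ 0`, the Riemann–Lebesgue lemma says that the exponentials
`exp(2πi k·Rx/η)` converge weakly to their mean as `η → 0`.  Density of trigonometric polynomials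
gives equidistribution in `L¹(Ω; C(T))` (`tendsto_integral_osc`).  The functionals
`φ ↦ ∫ u_j φ(x, Rx/η_j)` on the separable space `L²(Ω; C(T))` are bounded, so a subsequence has a
weak-* limit; by equidistribution of `φ²` the limit is bounded for the norm of `L²(Ω × T)`, hence is
represented by a function there (`exists_subseq_weakTwoScale`).

*Structure.* Let `u₀`, `c₀` be the limits of the fields and of their curls.  The test field
`η ψ(x) e_k(Rx/η) a` in the weak definition of the curl keeps in the limit only the derivative of
the oscillation, so `Rᵀk × û₀(x, k) = 0` (`integral_cross_wave_eq_zero`); the curl-free test field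
`η ∇(ψ(x) e_k(Rx/η))` gives `Rᵀk · ĉ₀(x, k) = 0` (`integral_wave_eq_zero`); a test field without
oscillation shows that the average of `u₀` has curl the average of `c₀` (`hasWeakCurl_integral`).
Hence the oscillating part of `u₀` is a `grad_R`, with potential `Rᵀk · û₀ / (2πi |Rᵀk|²)`, and that
of `c₀` is a `curl_R`, with potential `-Rᵀk × ĉ₀ / (2πi |Rᵀk|²)`.

*The space `H(curl, Ω; X)`.* For two `curl_R`-free fields `w`, `g` on the torus the coefficients of
index `k ≠ 0` are parallel to the same real vector `Rᵀk`, so by Parseval `∫ w · (b × g)` depends on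
the averages of `w` and `g` alone (`CurlRFree.integral_inner_cross`).  The `X`-valued curl of `u₀` is
therefore the curl of its average, viewed as a field constant in `y`.
-/

noncomputable section

namespace QuasiTwoScale

/-! ### Evaluation of `C(K)`-valued functions -/

section Evaluation

variable {X A K E : Type*} [MeasurableSpace X] [MeasurableSpace A]
  [TopologicalSpace K] [CompactSpace K] [NormedAddCommGroup E]
  {μ : Measure X} {ν : Measure A} {p : A → X} {θ : A → K}

lemma aestronglyMeasurable_eval {F : X → C(K, E)} (hF : AEStronglyMeasurable F μ)
    (hp : MeasurePreserving p ν μ) (hθ : AEStronglyMeasurable θ ν) :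
    AEStronglyMeasurable (fun a => F (p a) (θ a)) ν := by
  have h := (hF.comp_measurePreserving hp).prodMk hθ
  exact (continuous_eval (F := C(K, E))).comp_aestronglyMeasurable h

lemma eLpNorm_eval_le {F : X → C(K, E)} (hF : AEStronglyMeasurable F μ)
    (hp : MeasurePreserving p ν μ) (q : ENNReal) :
    eLpNorm (fun a => F (p a) (θ a)) q ν ≤ eLpNorm F q μ := by
  rw [← eLpNorm_comp_measurePreserving hF hp]
  exact eLpNorm_mono fun a => (F (p a)).norm_coe_le_norm _

lemma memLp_eval {F : X → C(K, E)} {q : ENNReal} (hF : MemLp F q μ)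
    (hp : MeasurePreserving p ν μ) (hθ : AEStronglyMeasurable θ ν) :
    MemLp (fun a => F (p a) (θ a)) q ν :=
  ⟨aestronglyMeasurable_eval hF.1 hp hθ, (eLpNorm_eval_le hF.1 hp q).trans_lt hF.2⟩

variable [NormedSpace ℝ E]

/-- Evaluation of `F ∈ L^q(X; C(K))` along a measure-preserving map `p` and a measurable map `θ`:
the contraction `F ↦ (a ↦ F (p a) (θ a))` into `L^q`.  Both the oscillating trace
`F(x, Rx/η)` and the function `F(x, y)` of two variables are of this form. -/
def evalLp (q : ENNReal) [Fact (1 ≤ q)]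
    (hp : MeasurePreserving p ν μ) (hθ : AEStronglyMeasurable θ ν) :
    Lp C(K, E) q μ →L[ℝ] Lp E q ν :=
  LinearMap.mkContinuous
    { toFun := fun F => (memLp_eval (Lp.memLp F) hp hθ).toLp _
      map_add' := fun F G => by
        rw [← MemLp.toLp_add]
        refine (MemLp.toLp_eq_toLp_iff _ _).2 ?_
        filter_upwards [hp.quasiMeasurePreserving.ae (Lp.coeFn_add F G)] with a ha
        rw [ha]
        rfl
      map_smul' := fun c F => by
        rw [RingHom.id_apply, ← MemLp.toLp_const_smul]
        refine (MemLp.toLp_eq_toLp_iff _ _).2 ?_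
        filter_upwards [hp.quasiMeasurePreserving.ae (Lp.coeFn_smul c F)] with a ha
        rw [ha]
        rfl } 1 fun F => by
    simp only [LinearMap.coe_mk, AddHom.coe_mk, one_mul]
    rw [Lp.norm_toLp, Lp.norm_def]
    exact ENNReal.toReal_mono (Lp.eLpNorm_ne_top F)
      (eLpNorm_eval_le (Lp.aestronglyMeasurable F) hp q)

lemma norm_evalLp_le (q : ENNReal) [Fact (1 ≤ q)]
    (hp : MeasurePreserving p ν μ) (hθ : AEStronglyMeasurable θ ν) :
    ‖evalLp (E := E) q hp hθ‖ ≤ 1 :=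
  LinearMap.mkContinuous_norm_le _ zero_le_one _

lemma evalLp_coeFn (q : ENNReal) [Fact (1 ≤ q)]
    (hp : MeasurePreserving p ν μ) (hθ : AEStronglyMeasurable θ ν) {F : X → C(K, E)}
    (hF : MemLp F q μ) :
    evalLp q hp hθ (hF.toLp F) =ᵐ[ν] fun a => F (p a) (θ a) := by
  refine (MemLp.coeFn_toLp (memLp_eval (Lp.memLp (hF.toLp F)) hp hθ)).trans ?_
  filter_upwards [hp.quasiMeasurePreserving.ae hF.coeFn_toLp] with a ha
  rw [ha]

end Evaluation

/-! ### The oscillating argument -/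

section Oscillation

variable {m : ℕ}

/-- The oscillating argument `x ↦ Rx/η` of the two-scale test functions, as a map to the torus. -/
def osc (R : Matrix (Fin m) (Fin 3) ℝ) (η : ℝ) (x : E3) : T m :=
  toTorus (η⁻¹ • (R *ᵥ x.ofLp))

lemma continuous_osc (R : Matrix (Fin m) (Fin 3) ℝ) (η : ℝ) : Continuous (osc R η) := by
  unfold osc toTorus
  refine continuous_pi fun j => (AddCircle.continuous_mk' 1).comp ?_
  fun_prop

/-- The vector `Rᵀk` as an element of `E3`. -/
def wave (R : Matrix (Fin m) (Fin 3) ℝ) (k : Fin m → ℤ) : E3 :=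
  WithLp.toLp 2 (Rᵀ *ᵥ fun j => (k j : ℝ))

lemma inner_wave (R : Matrix (Fin m) (Fin 3) ℝ) (k : Fin m → ℤ) (x : E3) :
    inner ℝ x (wave R k) = (R *ᵥ x.ofLp) ⬝ᵥ fun j => (k j : ℝ) := by
  rw [wave, EuclideanSpace.inner_eq_star_dotProduct, Matrix.mulVec_transpose,
    ← Matrix.dotProduct_mulVec, dotProduct_comm]
  simp

lemma mFourier_toTorus (k : Fin m → ℤ) (y : Fin m → ℝ) :
    UnitAddTorus.mFourier k (toTorus y) =
      Complex.exp (2 * Real.pi * Complex.I * ((y ⬝ᵥ fun j => (k j : ℝ) : ℝ) : ℂ)) := by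
  simp only [UnitAddTorus.mFourier, toTorus, ContinuousMap.coe_mk, fourier_coe_apply]
  rw [← Complex.exp_sum, dotProduct]
  congr 1
  push_cast
  rw [Finset.mul_sum]
  exact Finset.sum_congr rfl fun j _ => by ring

lemma mFourier_osc (R : Matrix (Fin m) (Fin 3) ℝ) (η : ℝ) (k : Fin m → ℤ) (x : E3) :
    UnitAddTorus.mFourier k (osc R η x) =
      Complex.exp (2 * Real.pi * Complex.I * ((η⁻¹ * inner ℝ x (wave R k) : ℝ) : ℂ)) := by
  rw [osc, mFourier_toTorus, smul_dotProduct, inner_wave, smul_eq_mul]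

lemma wave_ne_zero {R : Matrix (Fin m) (Fin 3) ℝ} (hR : Irrational R) {k : Fin m → ℤ}
    (hk : k ≠ 0) : wave R k ≠ 0 := by
  intro h
  exact hR k hk (congrArg WithLp.ofLp h)

lemma integral_mFourier_of_ne_zero {k : Fin m → ℤ} (hk : k ≠ 0) :
    ∫ y, UnitAddTorus.mFourier k y ∂(cellMeasure m) = 0 := by
  obtain ⟨i, hi⟩ := Function.ne_iff.mp hk
  simp only [UnitAddTorus.mFourier, ContinuousMap.coe_mk, cellMeasure]
  rw [integral_fintype_prod_eq_prod (𝕜 := ℂ) (f := fun i (x : UnitAddCircle) => fourier (k i) x)]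
  refine Finset.prod_eq_zero (Finset.mem_univ i) ?_
  exact integral_eq_zero_of_add_right_eq_neg (fourier_add_half_inv_index hi one_pos)

/-- Riemann–Lebesgue for the oscillating exponentials: they converge weakly to their mean. -/
lemma tendsto_integral_mFourier_osc {R : Matrix (Fin m) (Fin 3) ℝ} (hR : Irrational R)
    {η : ℕ → ℝ} (hη : ∀ j, 0 < η j) (hη0 : Tendsto η atTop (𝓝 0)) (k : Fin m → ℤ)
    (f : E3 → ℂ) :
    Tendsto (fun j => ∫ x, UnitAddTorus.mFourier k (osc R (η j) x) * f x) atTop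
      (𝓝 ((∫ x, f x) * ∫ y, UnitAddTorus.mFourier k y ∂(cellMeasure m))) := by
  rcases eq_or_ne k 0 with rfl | hk
  · simp [UnitAddTorus.mFourier_zero]
  rw [integral_mFourier_of_ne_zero hk, mul_zero]
  have hw : Tendsto (fun j => -((η j)⁻¹ • wave R k)) atTop (cocompact E3) := by
    rw [← Metric.cobounded_eq_cocompact, ← tendsto_norm_atTop_iff_cobounded]
    simp only [norm_neg, norm_smul, norm_inv, Real.norm_eq_abs]
    refine Tendsto.atTop_mul_const (norm_pos_iff.2 (wave_ne_zero hR hk)) ?_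
    refine tendsto_inv_nhdsGT_zero.comp (tendsto_nhdsWithin_iff.2 ⟨?_, ?_⟩)
    · simpa using hη0.abs
    · exact Eventually.of_forall fun j => abs_pos.2 (hη j).ne'
  refine ((tendsto_integral_exp_inner_smul_cocompact f).comp hw).congr fun j => ?_
  refine integral_congr_ae (Eventually.of_forall fun x => ?_)
  simp only [mFourier_osc, Circle.smul_def, Real.fourierChar_apply, inner_neg_right,
    neg_neg, inner_smul_right, smul_eq_mul]
  congr 2
  push_cast
  ring

end Oscillation

/-! ### Equidistribution -/

section Equidistribution

variable {m : ℕ}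

/-- Equidistribution against one continuous function on the torus.  The functionals
`c ↦ ∫ c(Rx/η) f(x) dx` are equi-Lipschitz, so it is enough to treat the exponentials, whose span
is dense. -/
lemma tendsto_integral_continuous_osc {R : Matrix (Fin m) (Fin 3) ℝ} (hR : Irrational R)
    {η : ℕ → ℝ} (hη : ∀ j, 0 < η j) (hη0 : Tendsto η atTop (𝓝 0)) (c : C(T m, ℂ))
    {f : E3 → ℂ} (hf : Integrable f) :
    Tendsto (fun j => ∫ x, c (osc R (η j) x) * f x) atTop
      (𝓝 ((∫ x, f x) * ∫ y, c y ∂(cellMeasure m))) := by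
  have hint : ∀ (c : C(T m, ℂ)) j, Integrable (fun x => c (osc R (η j) x) * f x) := fun c j =>
    hf.bdd_mul (c := ‖c‖) (c.continuous.comp (continuous_osc R _)).aestronglyMeasurable
      (Eventually.of_forall fun x => c.norm_coe_le_norm _)
  have hintT : ∀ c : C(T m, ℂ), Integrable (fun y => c y) (cellMeasure m) := fun c =>
    c.continuous.integrable_of_hasCompactSupport (HasCompactSupport.of_compactSpace _)
  set G : ℕ → C(T m, ℂ) → ℂ := fun j c => ∫ x, c (osc R (η j) x) * f x with hG
  set G0 : C(T m, ℂ) → ℂ := fun c => (∫ x, f x) * ∫ y, c y ∂(cellMeasure m) with hG0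
  -- Equicontinuity makes the set of `c` for which convergence holds closed.
  have hlip : ∀ j, LipschitzWith (∫ x, ‖f x‖).toNNReal (G j) := fun j => by
    refine LipschitzWith.of_dist_le_mul fun c c' => ?_
    rw [Real.coe_toNNReal _ (integral_nonneg fun _ => norm_nonneg _), dist_eq_norm, dist_eq_norm,
      mul_comm, ← integral_const_mul]
    simp only [hG]
    rw [← integral_sub (hint c j) (hint c' j)]
    refine norm_integral_le_of_norm_le (hf.norm.const_mul _) (Eventually.of_forall fun x => ?_)
    rw [← sub_mul, norm_mul]
    exact mul_le_mul_of_nonneg_right ((c - c').norm_coe_le_norm _) (norm_nonneg _)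
  have hcont : Continuous G0 := by
    refine continuous_const.mul ?_
    refine (LipschitzWith.of_dist_le_mul (K := 1) fun c c' => ?_).continuous
    rw [dist_eq_norm, dist_eq_norm, NNReal.coe_one, one_mul, ← integral_sub (hintT c) (hintT c')]
    refine (norm_integral_le_of_norm_le_const (Eventually.of_forall
      fun y => (c - c').norm_coe_le_norm y)).trans ?_
    simp
  have hclosed : IsClosed {c | Tendsto (fun j => G j c) atTop (𝓝 (G0 c))} :=
    (LipschitzWith.uniformEquicontinuous G _ hlip).equicontinuous.isClosed_setOfPred_tendsto hcont
  have hspan : ∀ c ∈ Submodule.span ℂ (Set.range (UnitAddTorus.mFourier (d := Fin m))),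
      c ∈ {c | Tendsto (fun j => G j c) atTop (𝓝 (G0 c))} := by
    intro c hc
    induction hc using Submodule.span_induction with
    | mem c hc =>
      obtain ⟨k, rfl⟩ := hc
      exact tendsto_integral_mFourier_osc hR hη hη0 k f
    | zero => simp [hG, hG0]
    | add c c' _ _ h h' =>
      have h2 := Tendsto.add h h'
      simp only [Set.mem_ofPred_eq]
      convert! h2 using 2
      · simp only [hG, ContinuousMap.add_apply, add_mul]
        rw [integral_add (hint c _) (hint c' _)]
      · simp only [hG0, ContinuousMap.add_apply]
        rw [integral_add (hintT c) (hintT c'), mul_add]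
    | smul a c _ h =>
      have h2 := Tendsto.const_mul a h
      simp only [Set.mem_ofPred_eq]
      convert! h2 using 2
      · simp only [hG, ContinuousMap.smul_apply, smul_eq_mul, mul_assoc]
        rw [integral_const_mul]
      · simp only [hG0, ContinuousMap.smul_apply, smul_eq_mul]
        rw [integral_const_mul]
        ring
  have hmem : c ∈ closure (Submodule.span ℂ
      (Set.range (UnitAddTorus.mFourier (d := Fin m))) : Set C(T m, ℂ)) := by
    rw [← Submodule.topologicalClosure_coe, UnitAddTorus.span_mFourier_closure_eq_top]
    trivial
  exact closure_minimal hspan hclosed hmem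

lemma measurePreserving_id_restrict (Ω : Set E3) :
    MeasurePreserving id (volume.restrict Ω) (volume.restrict Ω) :=
  MeasurePreserving.id _

lemma measurePreserving_fst_cell (Ω : Set E3) (m : ℕ) :
    MeasurePreserving (Prod.fst : E3 × T m → E3) (prodMeasure Ω m) (volume.restrict Ω) :=
  measurePreserving_fst

lemma aestronglyMeasurable_osc (Ω : Set E3) (R : Matrix (Fin m) (Fin 3) ℝ) (η : ℝ) :
    AEStronglyMeasurable (osc R η) (volume.restrict Ω) :=
  (continuous_osc R η).aestronglyMeasurable

lemma aestronglyMeasurable_snd_cell (Ω : Set E3) (m : ℕ) :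
    AEStronglyMeasurable (Prod.snd : E3 × T m → T m) (prodMeasure Ω m) :=
  measurable_snd.aestronglyMeasurable

/-- Equidistribution: for `F ∈ L¹(Ω; C(T))` the integral of the trace `F(x, Rx/η)` converges to the
double integral of `F`. -/
theorem tendsto_integral_osc {R : Matrix (Fin m) (Fin 3) ℝ} (hR : Irrational R)
    {η : ℕ → ℝ} (hη : ∀ j, 0 < η j) (hη0 : Tendsto η atTop (𝓝 0)) {Ω : Set E3}
    (hΩ : MeasurableSet Ω) {F : E3 → C(T m, ℂ)} (hF : MemLp F 1 (volume.restrict Ω)) :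
    Tendsto (fun j => ∫ x in Ω, F x (osc R (η j) x)) atTop
      (𝓝 (∫ z, F z.1 z.2 ∂(prodMeasure Ω m))) := by
  let G : ℕ → Lp C(T m, ℂ) 1 (volume.restrict Ω) →L[ℝ] ℂ := fun j =>
    L1.integralCLM ∘L evalLp 1 (measurePreserving_id_restrict Ω)
      (aestronglyMeasurable_osc Ω R (η j))
  let G0 : Lp C(T m, ℂ) 1 (volume.restrict Ω) →L[ℝ] ℂ :=
    L1.integralCLM ∘L evalLp 1 (measurePreserving_fst_cell Ω m)
      (aestronglyMeasurable_snd_cell Ω m)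
  have hGe : ∀ j (F : E3 → C(T m, ℂ)) (hF : MemLp F 1 (volume.restrict Ω)),
      G j (hF.toLp F) = ∫ x in Ω, F x (osc R (η j) x) := fun j F hF => by
    rw [ContinuousLinearMap.comp_apply, ← L1.integral_eq, L1.integral_eq_integral]
    exact integral_congr_ae (evalLp_coeFn 1 (measurePreserving_id_restrict Ω) _ hF)
  have hG0e : ∀ (F : E3 → C(T m, ℂ)) (hF : MemLp F 1 (volume.restrict Ω)),
      G0 (hF.toLp F) = ∫ z, F z.1 z.2 ∂(prodMeasure Ω m) := fun F hF => by
    rw [ContinuousLinearMap.comp_apply, ← L1.integral_eq, L1.integral_eq_integral]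
    exact integral_congr_ae (evalLp_coeFn 1 (measurePreserving_fst_cell Ω m) _ hF)
  -- For an indicator times a fixed `c` this is the previous lemma; the rest is density in `L¹`.
  have key : ∀ F : Lp C(T m, ℂ) 1 (volume.restrict Ω),
      Tendsto (fun j => G j F) atTop (𝓝 (G0 F)) := by
    refine Lp.induction ENNReal.one_ne_top _ ?_ ?_ ?_
    · intro c s hs hμs
      have hc : MemLp (s.indicator fun _ : E3 => c) 1 (volume.restrict Ω) :=
        memLp_indicator_const 1 hs c (Or.inr hμs.ne)
      have he : (Lp.simpleFunc.indicatorConst 1 hs hμs.ne c : Lp C(T m, ℂ) 1 (volume.restrict Ω))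
          = hc.toLp _ := by
        rw [Lp.simpleFunc.coe_indicatorConst]
        rfl
      rw [he, hG0e]
      simp only [hGe]
      have hfin : Integrable ((s ∩ Ω).indicator fun _ : E3 => (1 : ℂ)) := by
        rw [integrable_indicator_iff (hs.inter hΩ)]
        refine integrableOn_const (hs := ?_)
        rw [← Measure.restrict_apply hs]
        exact hμs.ne
      have h := tendsto_integral_continuous_osc hR hη hη0 c hfin
      convert! h using 2
      · rw [← integral_indicator hΩ]
        refine integral_congr_ae (Eventually.of_forall fun x => ?_)
        by_cases h1 : x ∈ s <;> by_cases h2 : x ∈ Ω <;> simp [h1, h2]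
      · rw [integral_indicator (hs.inter hΩ), ← Measure.restrict_restrict hs,
          ← integral_indicator hs, ← integral_prod_mul]
        refine integral_congr_ae (Eventually.of_forall fun z => ?_)
        by_cases h1 : z.1 ∈ s <;> simp [h1]
    · intro f g hf hg _ h1 h2
      simpa only [map_add] using h1.add h2
    · have hlip : ∀ j, LipschitzWith 1 (G j) := fun j => by
        refine (G j).lipschitz.weaken ?_
        refine (ContinuousLinearMap.opNorm_comp_le _ _).trans ?_
        exact mul_le_one₀ L1.norm_Integral_le_one (norm_nonneg _) (norm_evalLp_le _ _ _)
      exact (LipschitzWith.uniformEquicontinuous (fun j => ⇑(G j)) 1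
        hlip).equicontinuous.isClosed_setOfPred_tendsto G0.continuous
  have h := key (hF.toLp F)
  rw [hG0e] at h
  simpa only [hGe] using h

/-- The `L²` norms of the oscillating traces of `φ ∈ L²(Ω; C(T))` converge to its norm in
`L²(Ω × T)`. -/
lemma tendsto_integral_sq_osc {R : Matrix (Fin m) (Fin 3) ℝ} (hR : Irrational R)
    {η : ℕ → ℝ} (hη : ∀ j, 0 < η j) (hη0 : Tendsto η atTop (𝓝 0)) {Ω : Set E3}
    (hΩ : MeasurableSet Ω) {φ : E3 → C(T m, ℝ)} (hφ : MemLp φ 2 (volume.restrict Ω)) :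
    Tendsto (fun j => ∫ x in Ω, φ x (osc R (η j) x) ^ 2) atTop
      (𝓝 (∫ z, φ z.1 z.2 ^ 2 ∂(prodMeasure Ω m))) := by
  have hc : Continuous fun c : C(T m, ℝ) =>
      (ContinuousMap.mk (fun r : ℝ => (r : ℂ)) Complex.continuous_ofReal).comp (c * c) :=
    (ContinuousMap.continuous_postcomp _).comp (continuous_id.mul continuous_id)
  have hF : MemLp (fun x => (ContinuousMap.mk (fun r : ℝ => (r : ℂ))
      Complex.continuous_ofReal).comp (φ x * φ x)) 1 (volume.restrict Ω) := by
    have h2 : MemLp (φ * φ) 1 (volume.restrict Ω) := hφ.mul hφ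
    refine h2.mono (hc.comp_aestronglyMeasurable hφ.1) (Eventually.of_forall fun x => ?_)
    refine (ContinuousMap.norm_le _ (norm_nonneg _)).2 fun y => ?_
    have := (φ x * φ x).norm_coe_le_norm y
    simpa using this
  have h := tendsto_integral_osc hR hη hη0 hΩ hF
  have h' := (Complex.continuous_re.tendsto _).comp h
  convert! h' using 2
  · rename_i j
    simp only [Function.comp, ContinuousMap.comp_apply, ContinuousMap.coe_mk]
    rw [integral_complex_ofReal, Complex.ofReal_re]
    simp [pow_two]
  · simp only [ContinuousMap.comp_apply, ContinuousMap.coe_mk]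
    rw [integral_complex_ofReal, Complex.ofReal_re]
    simp [pow_two]

end Equidistribution

/-! ### Compactness for weak two-scale convergence -/

/-- A functional dominated by `‖J ·‖`, where `J` takes values in a Hilbert space, is represented by
a vector of that space. -/
lemma exists_inner_eq_of_norm_le {B H : Type*} [NormedAddCommGroup B] [NormedSpace ℝ B]
    [NormedAddCommGroup H] [InnerProductSpace ℝ H] [CompleteSpace H] (J : B →L[ℝ] H)
    (l : B →L[ℝ] ℝ) (C : ℝ) (h : ∀ x, ‖l x‖ ≤ C * ‖J x‖) :
    ∃ w : H, ∀ x, l x = inner ℝ w (J x) := by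
  have hker : LinearMap.ker J.toLinearMap ≤ LinearMap.ker l.toLinearMap := fun x hx => by
    have h0 : J x = 0 := hx
    have := h x
    rw [h0, norm_zero, mul_zero] at this
    exact norm_le_zero_iff.1 this
  let f0 : LinearMap.range J.toLinearMap →ₗ[ℝ] ℝ :=
    (LinearMap.ker J.toLinearMap).liftQ l.toLinearMap hker ∘ₗ
      J.toLinearMap.quotKerEquivRange.symm.toLinearMap
  have hf0 : ∀ x, f0 ⟨J x, LinearMap.mem_range_self J.toLinearMap x⟩ = l x := fun x => by
    have : J.toLinearMap.quotKerEquivRange.symm ⟨J x, LinearMap.mem_range_self J.toLinearMap x⟩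
        = Submodule.Quotient.mk x := by
      rw [LinearEquiv.symm_apply_eq]
      rfl
    simp only [f0, LinearMap.comp_apply, LinearEquiv.coe_coe, this]
    rfl
  obtain ⟨g, hg, -⟩ := exists_extension_norm_eq (𝕜 := ℝ) (LinearMap.range J.toLinearMap)
    (f0.mkContinuous C (by
      rintro ⟨_, x, rfl⟩
      exact (congrArg norm (hf0 x)).le.trans (h x)))
  refine ⟨(InnerProductSpace.toDual ℝ H).symm g, fun x => ?_⟩
  rw [InnerProductSpace.toDual_symm_apply, ← hf0 x]
  exact (hg ⟨J x, LinearMap.mem_range_self J.toLinearMap x⟩).symm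

lemma norm_evalLp_sq {X A K : Type*} [MeasurableSpace X] [MeasurableSpace A]
    [TopologicalSpace K] [CompactSpace K] {μ : Measure X} {ν : Measure A} {p : A → X} {θ : A → K}
    (hp : MeasurePreserving p ν μ) (hθ : AEStronglyMeasurable θ ν) {φ : X → C(K, ℝ)}
    (hφ : MemLp φ 2 μ) :
    ‖evalLp 2 hp hθ (hφ.toLp φ)‖ ^ 2 = ∫ a, φ (p a) (θ a) ^ 2 ∂ν := by
  rw [← real_inner_self_eq_norm_sq, L2.inner_def]
  refine integral_congr_ae ?_
  filter_upwards [evalLp_coeFn 2 hp hθ hφ] with a ha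
  rw [ha, real_inner_self_eq_norm_sq, Real.norm_eq_abs, sq_abs]

lemma inner_evalLp {X A K : Type*} [MeasurableSpace X] [MeasurableSpace A]
    [TopologicalSpace K] [CompactSpace K] {μ : Measure X} {ν : Measure A} {p : A → X} {θ : A → K}
    (hp : MeasurePreserving p ν μ) (hθ : AEStronglyMeasurable θ ν) {φ : X → C(K, ℝ)}
    (hφ : MemLp φ 2 μ) (v : Lp ℝ 2 ν) :
    inner ℝ v (evalLp 2 hp hθ (hφ.toLp φ)) = ∫ a, v a * φ (p a) (θ a) ∂ν := by
  rw [L2.inner_def]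
  refine integral_congr_ae ?_
  filter_upwards [evalLp_coeFn 2 hp hθ hφ] with a ha
  rw [ha, RCLike.inner_apply, mul_comm]
  simp

variable {m : ℕ}

/-- Compactness: a bounded sequence of `L²(Ω)` has a weakly two-scale convergent subsequence.  The
functionals `φ ↦ ∫ v_j φ(x, Rx/η_j)` on the separable space `L²(Ω; C(T))` have a weak-* limit, which
by equidistribution is bounded for the norm of `L²(Ω × T)`. -/
theorem exists_subseq_weakTwoScale {R : Matrix (Fin m) (Fin 3) ℝ} (hR : Irrational R)
    {η : ℕ → ℝ} (hη : ∀ j, 0 < η j) (hη0 : Tendsto η atTop (𝓝 0)) {Ω : Set E3}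
    (hΩ : MeasurableSet Ω) {v : ℕ → E3 → ℝ} (hv : ∀ j, MemLp (v j) 2 (volume.restrict Ω)) {C : ℝ}
    (hC : ∀ j, eLpNorm (v j) 2 (volume.restrict Ω) ≤ ENNReal.ofReal C) :
    ∃ (s : ℕ → ℕ) (u₀ : E3 × T m → ℝ), StrictMono s ∧
      WeakTwoScale Ω R (fun k => η (s k)) (fun k => v (s k)) u₀ := by
  have : Fact ((2 : ENNReal) ≠ ⊤) := ⟨ENNReal.ofNat_ne_top⟩
  let ev : ℕ → Lp C(T m, ℝ) 2 (volume.restrict Ω) →L[ℝ] Lp ℝ 2 (volume.restrict Ω) := fun j =>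
    evalLp 2 (measurePreserving_id_restrict Ω) (aestronglyMeasurable_osc Ω R (η j))
  let J : Lp C(T m, ℝ) 2 (volume.restrict Ω) →L[ℝ] Lp ℝ 2 (prodMeasure Ω m) :=
    evalLp 2 (measurePreserving_fst_cell Ω m) (aestronglyMeasurable_snd_cell Ω m)
  let l : ℕ → Lp C(T m, ℝ) 2 (volume.restrict Ω) →L[ℝ] ℝ := fun j =>
    innerSL ℝ ((hv j).toLp (v j)) ∘L ev j
  have hvn : ∀ j, ‖(hv j).toLp (v j)‖ ≤ max C 0 := fun j => by
    rw [Lp.norm_toLp]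
    exact ENNReal.toReal_le_of_le_ofReal (le_max_right _ _)
      ((hC j).trans (ENNReal.ofReal_le_ofReal (le_max_left _ _)))
  have hlb : ∀ j F, ‖l j F‖ ≤ max C 0 * ‖ev j F‖ := fun j F =>
    (norm_inner_le_norm _ _).trans (mul_le_mul_of_nonneg_right (hvn j) (norm_nonneg _))
  have hle : ∀ j (φ : E3 → C(T m, ℝ)) (hφ : MemLp φ 2 (volume.restrict Ω)),
      l j (hφ.toLp φ) = ∫ x in Ω, v j x * φ x (toTorus ((η j)⁻¹ • (R *ᵥ x.ofLp))) :=
    fun j φ hφ => by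
      refine (inner_evalLp (measurePreserving_id_restrict Ω) _ hφ _).trans ?_
      refine integral_congr_ae ?_
      filter_upwards [(hv j).coeFn_toLp] with x hx
      rw [hx]
      rfl
  have hnorm : ∀ j, l j ∈ Metric.closedBall (0 : StrongDual ℝ _) (max C 0) := fun j => by
    refine (dist_zero_right (l j)).trans_le ?_
    refine (l j).opNorm_le_bound (le_max_right _ _) fun F => (hlb j F).trans ?_
    refine mul_le_mul_of_nonneg_left ?_ (le_max_right _ _)
    simpa using (ev j).le_of_opNorm_le (norm_evalLp_le _ _ _) F
  obtain ⟨l0, -, s, hs, hlim⟩ := WeakDual.isSeqCompact_closedBall ℝ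
    (Lp C(T m, ℝ) 2 (volume.restrict Ω)) 0 (max C 0)
    (x := fun j => StrongDual.toWeakDual (l j)) hnorm
  have hlimF : ∀ F, Tendsto (fun k => l (s k) F) atTop (𝓝 (l0 F)) := fun F =>
    ((WeakDual.eval_continuous F).tendsto l0).comp hlim
  have hs0 : Tendsto (fun k => η (s k)) atTop (𝓝 0) := hη0.comp hs.tendsto_atTop
  -- `‖l0 F‖ ≤ C lim ‖F(x, Rx/η)‖`, and by equidistribution that limit is `‖J F‖`.
  have hbound : ∀ F, ‖l0 F‖ ≤ max C 0 * ‖J F‖ := fun F => by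
    have hF := Lp.memLp F
    have hsq := tendsto_integral_sq_osc hR (fun k => hη (s k)) hs0 hΩ hF
    have hn : Tendsto (fun k => ‖ev (s k) F‖) atTop (𝓝 ‖J F‖) := by
      have h1 : ∀ k, ‖ev (s k) F‖ ^ 2 = ∫ x in Ω, F x (osc R (η (s k)) x) ^ 2 := fun k => by
        have := norm_evalLp_sq (measurePreserving_id_restrict Ω)
          (aestronglyMeasurable_osc Ω R (η (s k))) hF
        rwa [Lp.toLp_coeFn] at this
      have h2 : ‖J F‖ ^ 2 = ∫ z, F z.1 z.2 ^ 2 ∂(prodMeasure Ω m) := by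
        have := norm_evalLp_sq (measurePreserving_fst_cell Ω m)
          (aestronglyMeasurable_snd_cell Ω m) hF
        rwa [Lp.toLp_coeFn] at this
      simp only [← h1, ← h2] at hsq
      simpa using hsq.sqrt
    exact le_of_tendsto_of_tendsto' (hlimF F).norm (hn.const_mul _) fun k => hlb (s k) F
  obtain ⟨w, hw⟩ := exists_inner_eq_of_norm_le J (WeakDual.toStrongDual l0) _ hbound
  refine ⟨s, w, hs, Lp.memLp w, fun φ hφ => ?_⟩
  have h := hlimF (hφ.toLp φ)
  rw [show l0 (hφ.toLp φ) = _ from hw _] at h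
  rw [show inner ℝ w (J (hφ.toLp φ)) = _ from
    inner_evalLp (measurePreserving_fst_cell Ω m) _ hφ w] at h
  exact h.congr fun k => hle (s k) φ hφ

lemma WeakTwoScale.comp_strictMono {Ω : Set E3} {R : Matrix (Fin m) (Fin 3) ℝ} {η : ℕ → ℝ}
    {v : ℕ → E3 → ℝ} {v₀ : E3 × T m → ℝ} (h : WeakTwoScale Ω R η v v₀) {s : ℕ → ℕ}
    (hs : StrictMono s) : WeakTwoScale Ω R (fun k => η (s k)) (fun k => v (s k)) v₀ :=
  ⟨h.1, fun φ hφ => (h.2 φ hφ).comp hs.tendsto_atTop⟩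

lemma exists_subseq_weakTwoScale_fin {R : Matrix (Fin m) (Fin 3) ℝ} (hR : Irrational R)
    {η : ℕ → ℝ} (hη : ∀ j, 0 < η j) (hη0 : Tendsto η atTop (𝓝 0)) {Ω : Set E3}
    (hΩ : MeasurableSet Ω) {C : ℝ} {n : ℕ} {v : Fin n → ℕ → E3 → ℝ}
    (hv : ∀ i j, MemLp (v i j) 2 (volume.restrict Ω))
    (hC : ∀ i j, eLpNorm (v i j) 2 (volume.restrict Ω) ≤ ENNReal.ofReal C) :
    ∃ (s : ℕ → ℕ) (u₀ : Fin n → E3 × T m → ℝ), StrictMono s ∧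
      ∀ i, WeakTwoScale Ω R (fun k => η (s k)) (fun k => v i (s k)) (u₀ i) := by
  induction n with
  | zero => exact ⟨id, fun _ => 0, strictMono_id, fun i => i.elim0⟩
  | succ n ih =>
    obtain ⟨s, u, hs, hu⟩ := ih (v := fun i => v i.castSucc) (fun i => hv _) (fun i => hC _)
    obtain ⟨t, w, ht, hw⟩ := exists_subseq_weakTwoScale hR (fun k => hη (s k))
      (hη0.comp hs.tendsto_atTop) hΩ (v := fun k => v (Fin.last n) (s k)) (fun _ => hv _ _)
      (fun _ => hC _ _)
    refine ⟨fun k => s (t k), Fin.snoc u w, hs.comp ht, fun i => ?_⟩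
    induction i using Fin.lastCases with
    | last => simpa using hw
    | cast i => simpa using (hu i).comp_strictMono ht

/-- Simultaneous extraction for two bounded sequences of vector fields. -/
lemma exists_subseq_weakTwoScaleVec {R : Matrix (Fin m) (Fin 3) ℝ} (hR : Irrational R)
    {η : ℕ → ℝ} (hη : ∀ j, 0 < η j) (hη0 : Tendsto η atTop (𝓝 0)) {Ω : Set E3}
    (hΩ : MeasurableSet Ω) {C : ℝ} {v w : ℕ → E3 → E3}
    (hv : ∀ j, MemLp (v j) 2 (volume.restrict Ω)) (hw : ∀ j, MemLp (w j) 2 (volume.restrict Ω))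
    (hC : ∀ j, eLpNorm (v j) 2 (volume.restrict Ω) + eLpNorm (w j) 2 (volume.restrict Ω)
      ≤ ENNReal.ofReal C) :
    ∃ (s : ℕ → ℕ) (v₀ w₀ : E3 × T m → E3), StrictMono s ∧
      MemLp v₀ 2 (prodMeasure Ω m) ∧ MemLp w₀ 2 (prodMeasure Ω m) ∧
      WeakTwoScaleVec Ω R (fun k => η (s k)) (fun k => v (s k)) v₀ ∧
      WeakTwoScaleVec Ω R (fun k => η (s k)) (fun k => w (s k)) w₀ := by
  obtain ⟨s, u, hs, hu⟩ := exists_subseq_weakTwoScale_fin hR hη hη0 hΩ (C := C) (n := 6)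
    (v := Fin.append (m := 3) (n := 3) (fun i j x => v j x i) (fun i j x => w j x i))
    (fun i j => by
      refine Fin.addCases (m := 3) (n := 3) (fun i => ?_) (fun i => ?_) i
      · simp only [Fin.append_left]
        exact (hv j).eval_piLp i
      · simp only [Fin.append_right]
        exact (hw j).eval_piLp i)
    (fun i j => by
      refine Fin.addCases (m := 3) (n := 3) (fun i => ?_) (fun i => ?_) i
      · simp only [Fin.append_left]
        exact (eLpNorm_mono fun x => PiLp.norm_apply_le _ _).trans (le_self_add.trans (hC j))
      · simp only [Fin.append_right]
        exact (eLpNorm_mono fun x => PiLp.norm_apply_le _ _).trans (le_add_self.trans (hC j)))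
  have h1 : ∀ i : Fin 3, WeakTwoScale Ω R (fun k => η (s k)) (fun k x => v (s k) x i)
      (u (Fin.castAdd 3 i)) := fun i => by
    simpa only [Fin.append_left] using hu (Fin.castAdd 3 i)
  have h2 : ∀ i : Fin 3, WeakTwoScale Ω R (fun k => η (s k)) (fun k x => w (s k) x i)
      (u (Fin.natAdd 3 i)) := fun i => by
    simpa only [Fin.append_right] using hu (Fin.natAdd 3 i)
  exact ⟨s, fun z => WithLp.toLp 2 fun i => u (Fin.castAdd 3 i) z,
    fun z => WithLp.toLp 2 fun i => u (Fin.natAdd 3 i) z, hs,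
    MemLp.of_eval_piLp fun i => (h1 i).1, MemLp.of_eval_piLp fun i => (h2 i).1, h1, h2⟩

/-! ### Vector calculus for oscillating test fields -/

lemma gradient_apply (f : E3 → ℝ) (x : E3) (i : Fin 3) :
    gradient f x i = fderiv ℝ f x (EuclideanSpace.single i 1) := by
  rw [← inner_gradient_left, EuclideanSpace.inner_single_right]
  simp

lemma cross_add_left (a b c : E3) : cross (a + b) c = cross a c + cross b c := by
  simp [cross]

lemma cross_smul_left (r : ℝ) (a c : E3) : cross (r • a) c = r • cross a c := by
  simp [cross]

lemma curl_smul_const {f : E3 → ℝ} {x : E3} (hf : DifferentiableAt ℝ f x) (a : E3) :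
    curl (fun x => f x • a) x = cross (gradient f x) a := by
  have h : ∀ i j, pd i j (fun x => f x • a) x = gradient f x i * a j := fun i j => by
    rw [pd, fderiv_smul_const hf, gradient_apply]
    simp
  ext i
  fin_cases i <;> simp [curl, h, cross, cross_apply]

lemma pd_gradient {f : E3 → ℝ} (hf : ContDiff ℝ 2 f) (i j : Fin 3) (x : E3) :
    pd i j (gradient f) x =
      fderiv ℝ (fderiv ℝ f) x (EuclideanSpace.single i 1) (EuclideanSpace.single j 1) := by
  have hd : DifferentiableAt ℝ (fderiv ℝ f) x :=
    (hf.fderiv_right (m := 1) (by norm_num)).differentiable one_ne_zero x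
  have hg : gradient f = (InnerProductSpace.toDual ℝ E3).symm ∘ fderiv ℝ f := rfl
  have hgd : DifferentiableAt ℝ (gradient f) x := by
    rw [hg]
    exact ((InnerProductSpace.toDual ℝ E3).symm.toContinuousLinearEquiv.differentiableAt).comp x hd
  have h1 : HasFDerivAt (fun y => gradient f y j)
      ((EuclideanSpace.proj j : E3 →L[ℝ] ℝ) ∘L fderiv ℝ (gradient f) x) x :=
    (EuclideanSpace.proj j : E3 →L[ℝ] ℝ).hasFDerivAt.comp x hgd.hasFDerivAt
  have h2 : HasFDerivAt (fun y => fderiv ℝ f y (EuclideanSpace.single j 1))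
      ((fderiv ℝ (fderiv ℝ f) x).flip (EuclideanSpace.single j 1)) x := by
    simpa using hd.hasFDerivAt.clm_apply
      (hasFDerivAt_const (EuclideanSpace.single j (1 : ℝ) : E3) x)
  simp only [gradient_apply] at h1
  have := congrArg (fun L : E3 →L[ℝ] ℝ => L (EuclideanSpace.single i 1)) (h1.unique h2)
  simpa [pd] using this

lemma curl_gradient {f : E3 → ℝ} (hf : ContDiff ℝ 2 f) (x : E3) : curl (gradient f) x = 0 := by
  have hs : IsSymmSndFDerivAt ℝ f x := hf.contDiffAt.isSymmSndFDerivAt (by simp)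
  have h : ∀ i j, pd i j (gradient f) x - pd j i (gradient f) x = 0 := fun i j => by
    rw [pd_gradient hf, pd_gradient hf, hs.eq, sub_self]
  simp only [curl, h]
  ext i
  fin_cases i <;> rfl

lemma contDiff_gradient {f : E3 → ℝ} (hf : ContDiff ℝ ∞ f) : ContDiff ℝ ∞ (gradient f) := by
  have hg : gradient f = (InnerProductSpace.toDual ℝ E3).symm ∘ fderiv ℝ f := rfl
  rw [hg]
  exact (InnerProductSpace.toDual ℝ E3).symm.toContinuousLinearEquiv.contDiff.comp
    (hf.fderiv_right (m := ∞) (by simp))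

lemma tsupport_gradient_subset (f : E3 → ℝ) : tsupport (gradient f) ⊆ tsupport f := by
  have hg : gradient f = (InnerProductSpace.toDual ℝ E3).symm ∘ fderiv ℝ f := rfl
  rw [hg]
  refine (closure_mono (Function.support_comp_subset (map_zero _) _)).trans ?_
  exact tsupport_fderiv_subset ℝ

lemma IsTest.gradient {Ω : Set E3} {f : E3 → ℝ} (hf : IsTest Ω f) : IsTest Ω (gradient f) :=
  ⟨contDiff_gradient hf.1, hf.2.1.mono' (subset_closure.trans (tsupport_gradient_subset f)),
    (tsupport_gradient_subset f).trans hf.2.2⟩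

lemma IsTest.smul_const {Ω : Set E3} {f : E3 → ℝ} (hf : IsTest Ω f) (a : E3) :
    IsTest Ω (fun x => f x • a) :=
  ⟨hf.1.smul contDiff_const, hf.2.1.smul_right,
    (tsupport_smul_subset_left f fun _ => a).trans hf.2.2⟩

lemma IsTest.mul_right {Ω : Set E3} {f g : E3 → ℝ} (hf : IsTest Ω f) (hg : ContDiff ℝ ∞ g) :
    IsTest Ω (fun x => f x * g x) :=
  ⟨hf.1.mul hg, hf.2.1.mul_right, (tsupport_mul_subset_left (f := f) (g := g)).trans hf.2.2⟩

lemma IsTest.memLp {F : Type*} [NormedAddCommGroup F] [NormedSpace ℝ F] {Ω : Set E3} {f : E3 → F}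
    (hf : IsTest Ω f) (μ : Measure E3) [IsFiniteMeasureOnCompacts μ] (p : ENNReal) :
    MemLp f p μ :=
  hf.1.continuous.memLp_of_hasCompactSupport hf.2.1

section Osc

variable {m : ℕ}

/-- The real trigonometric monomial `Re (ζ exp(2πi k·y))`. -/
def trig (k : Fin m → ℤ) (ζ : ℂ) : C(T m, ℝ) where
  toFun y := (ζ * UnitAddTorus.mFourier k y).re
  continuous_toFun := by fun_prop

lemma trig_apply (k : Fin m → ℤ) (ζ : ℂ) (y : T m) :
    trig k ζ y = (ζ * UnitAddTorus.mFourier k y).re := rfl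

lemma contDiff_trig_osc (R : Matrix (Fin m) (Fin 3) ℝ) (η : ℝ) (k : Fin m → ℤ) (ζ : ℂ) :
    ContDiff ℝ ∞ fun x => trig k ζ (osc R η x) := by
  simp only [trig_apply, mFourier_osc]
  refine Complex.reCLM.contDiff.comp (contDiff_const.mul (ContDiff.cexp (contDiff_const.mul ?_)))
  exact Complex.ofRealCLM.contDiff.comp (contDiff_const.mul (contDiff_id.inner ℝ contDiff_const))

lemma hasGradientAt_trig_osc (R : Matrix (Fin m) (Fin 3) ℝ) (η : ℝ) (k : Fin m → ℤ) (ζ : ℂ)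
    (x : E3) :
    HasGradientAt (fun x => trig k ζ (osc R η x))
      ((η⁻¹ * trig k (2 * Real.pi * Complex.I * ζ) (osc R η x)) • wave R k) x := by
  simp only [trig_apply, mFourier_osc]
  rw [hasGradientAt_iff_hasFDerivAt]
  have h1 : HasFDerivAt (fun x : E3 => η⁻¹ * inner ℝ x (wave R k))
      (η⁻¹ • (innerSL ℝ (wave R k))) x := by
    have := ((innerSL ℝ (wave R k)).hasFDerivAt (x := x)).const_mul η⁻¹
    refine this.congr_of_eventuallyEq (Eventually.of_forall fun y => ?_)
    simp [real_inner_comm]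
  have h2 : HasFDerivAt (fun x : E3 => ((η⁻¹ * inner ℝ x (wave R k) : ℝ) : ℂ)) _ x :=
    Complex.ofRealCLM.hasFDerivAt.comp x h1
  have h3 := ((h2.const_mul (2 * Real.pi * Complex.I : ℂ)).cexp).const_mul ζ
  have h4 := Complex.reCLM.hasFDerivAt.comp x h3
  refine h4.congr_fderiv ?_
  ext v
  simp [-Complex.mul_re]
  set E := Complex.exp (2 * Real.pi * Complex.I * ((η : ℂ)⁻¹ * (inner ℝ x (wave R k) : ℝ)))
  rw [show ζ * (E * (2 * Real.pi * Complex.I * ((η : ℂ)⁻¹ * (inner ℝ (wave R k) v : ℝ))))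
    = ((η⁻¹ * inner ℝ (wave R k) v : ℝ) : ℂ) * (2 * Real.pi * Complex.I * ζ * E) by
      push_cast; ring, Complex.re_ofReal_mul]
  ring

lemma gradient_mul_trig_osc (R : Matrix (Fin m) (Fin 3) ℝ) {η : ℝ} (k : Fin m → ℤ)
    (ζ : ℂ) {ψ : E3 → ℝ} {x : E3} (hψ : DifferentiableAt ℝ ψ x) :
    gradient (fun x => ψ x * trig k ζ (osc R η x)) x =
      trig k ζ (osc R η x) • gradient ψ x +
        η⁻¹ • trig k (2 * Real.pi * Complex.I * ζ) (osc R η x) • ψ x • wave R k := by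
  have h1 := hψ.hasGradientAt.hasFDerivAt.mul (hasGradientAt_trig_osc R η k ζ x).hasFDerivAt
  refine (hasGradientAt_iff_hasFDerivAt.2 (h1.congr_fderiv ?_)).gradient
  simp only [map_add, map_smul, smul_smul]
  rw [add_comm]
  congr 2
  ring

end Osc

/-! ### Fields of `L²(Ω × T)`: slices and cell averages -/

lemma integrable_inner_of_memLp {A : Type*} [MeasurableSpace A] {ν : Measure A} {v w : A → E3}
    (hv : MemLp v 2 ν) (hw : MemLp w 2 ν) : Integrable (fun a => inner ℝ (v a) (w a)) ν := by
  simp only [PiLp.inner_apply]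
  refine integrable_finsetSum _ fun i _ => ?_
  exact (hw.eval_piLp i).integrable_mul (hv.eval_piLp i)

lemma integrable_inner_mul {A K : Type*} [MeasurableSpace A] {ν : Measure A}
    [TopologicalSpace K] [CompactSpace K] {v w : A → E3}
    (hv : MemLp v 2 ν) (hw : MemLp w 2 ν) (g : C(K, ℝ)) {θ : A → K}
    (hθ : AEStronglyMeasurable θ ν) :
    Integrable (fun a => inner ℝ (v a) (w a) * g (θ a)) ν :=
  (integrable_inner_of_memLp hv hw).mul_bdd (c := ‖g‖)
    (g.continuous.comp_aestronglyMeasurable hθ)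
    (Eventually.of_forall fun a => g.norm_coe_le_norm (θ a))

section Slices

variable {X Y : Type*} [MeasurableSpace X] [MeasurableSpace Y] {μ : Measure X} {ν : Measure Y}
  [IsFiniteMeasure μ] [IsProbabilityMeasure ν]

lemma ae_memLp_slice {v : X × Y → E3} (hv : MemLp v 2 (μ.prod ν)) :
    ∀ᵐ x ∂μ, MemLp (fun y => v (x, y)) 2 ν := by
  filter_upwards [hv.1.prodMk_left, ((memLp_two_iff_integrable_sq_norm hv.1).1 hv).prod_right_ae]
    with x h1 h2
  exact (memLp_two_iff_integrable_sq_norm h1).2 h2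

lemma sq_norm_integral_le {w : Y → E3} (hw : MemLp w 2 ν) :
    ‖∫ y, w y ∂ν‖ ^ 2 ≤ ∫ y, ‖w y‖ ^ 2 ∂ν := by
  have h := ProbabilityTheory.variance_eq_sub hw.norm
  have h0 := ProbabilityTheory.variance_nonneg (fun y => ‖w y‖) ν
  rw [h] at h0
  refine (pow_le_pow_left₀ (norm_nonneg _) (norm_integral_le_integral_norm w) 2).trans ?_
  simpa using h0

lemma memLp_integral_right {v : X × Y → E3} (hv : MemLp v 2 (μ.prod ν)) :
    MemLp (fun x => ∫ y, v (x, y) ∂ν) 2 μ := by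
  have hm : AEStronglyMeasurable (fun x => ∫ y, v (x, y) ∂ν) μ := hv.1.integral_prod_right'
  rw [memLp_two_iff_integrable_sq_norm hm]
  refine ((memLp_two_iff_integrable_sq_norm hv.1).1 hv).integral_prod_left.mono'
    (hm.norm.pow 2) ?_
  filter_upwards [ae_memLp_slice hv] with x hx
  rw [Real.norm_of_nonneg (sq_nonneg _)]
  exact sq_norm_integral_le hx

lemma integral_inner_fst {v : X × Y → E3} (hv : MemLp v 2 (μ.prod ν)) {W : X → E3}
    (hW : MemLp W 2 μ) :
    ∫ z, inner ℝ (v z) (W z.1) ∂(μ.prod ν) = ∫ x, inner ℝ (∫ y, v (x, y) ∂ν) (W x) ∂μ := by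
  have hW' : MemLp (fun z : X × Y => W z.1) 2 (μ.prod ν) :=
    hW.comp_measurePreserving measurePreserving_fst
  rw [integral_prod _ (integrable_inner_of_memLp hv hW')]
  refine integral_congr_ae ?_
  filter_upwards [ae_memLp_slice hv] with x hx
  simp only [real_inner_comm (W x)]
  exact integral_inner (hx.integrable one_le_two) (W x)

end Slices

/-! ### Passing to the two-scale limit -/

section Limits

variable {m : ℕ} {Ω : Set E3} {R : Matrix (Fin m) (Fin 3) ℝ} {η : ℕ → ℝ}

lemma WeakTwoScaleVec.tendsto_integral_inner {v : ℕ → E3 → E3} {v₀ : E3 × T m → E3}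
    (h : WeakTwoScaleVec Ω R η v v₀) (hv : ∀ j, MemLp (v j) 2 (volume.restrict Ω))
    (hv₀ : MemLp v₀ 2 (prodMeasure Ω m)) {Ψ : E3 → E3} (hΨ : MemLp Ψ 2 (volume.restrict Ω))
    (g : C(T m, ℝ)) :
    Tendsto (fun j => ∫ x in Ω, inner ℝ (v j x) (Ψ x) * g (osc R (η j) x)) atTop
      (𝓝 (∫ z, inner ℝ (v₀ z) (Ψ z.1) * g z.2 ∂(prodMeasure Ω m))) := by
  have hφ : ∀ i, MemLp (fun x => Ψ x i • g) 2 (volume.restrict Ω) := fun i =>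
    ((1 : ℝ →L[ℝ] ℝ).smulRight g).comp_memLp' (hΨ.eval_piLp i)
  have key := tendsto_finsetSum Finset.univ fun i (_ : i ∈ Finset.univ) => (h i).2 _ (hφ i)
  convert! key using 2
  · rw [← integral_finsetSum]
    · refine integral_congr_ae (Eventually.of_forall fun x => ?_)
      simp only [PiLp.inner_apply, Finset.sum_mul]
      refine Finset.sum_congr rfl fun i _ => ?_
      simp [osc]
      ring
    · intro i _
      exact ((hv _).eval_piLp i).integrable_mul (memLp_eval (hφ i)
        (measurePreserving_id_restrict Ω) (aestronglyMeasurable_osc Ω R _))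
  · rw [← integral_finsetSum]
    · refine integral_congr_ae (Eventually.of_forall fun x => ?_)
      simp only [PiLp.inner_apply, Finset.sum_mul]
      refine Finset.sum_congr rfl fun i _ => ?_
      simp
      ring
    · intro i _
      exact (hv₀.eval_piLp i).integrable_mul (memLp_eval (hφ i)
        (measurePreserving_fst_cell Ω m) (aestronglyMeasurable_snd_cell Ω m))

lemma contDiff_pd {ψ : E3 → E3} (hψ : ContDiff ℝ ∞ ψ) (i j : Fin 3) : ContDiff ℝ ∞ (pd i j ψ) :=
  (EuclideanSpace.proj j : E3 →L[ℝ] ℝ).contDiff.comp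
    ((hψ.fderiv_right (m := ∞) (by simp)).clm_apply contDiff_const)

lemma IsTest.memLp_curl {ψ : E3 → E3} (hψ : IsTest Ω ψ) (μ : Measure E3)
    [IsFiniteMeasureOnCompacts μ] : MemLp (curl ψ) 2 μ := by
  have hc : Continuous (curl ψ) := by
    refine (PiLp.continuous_toLp 2 _).comp (continuous_pi fun i => ?_)
    have h := fun i j => (contDiff_pd hψ.1 i j).continuous
    fin_cases i
    · exact (h 1 2).sub (h 2 1)
    · exact (h 2 0).sub (h 0 2)
    · exact (h 0 1).sub (h 1 0)
  refine hc.memLp_of_hasCompactSupport (hψ.2.1.mono' fun x hx => ?_)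
  by_contra hx'
  refine hx ?_
  have h : ∀ i j, pd i j ψ x = 0 := fun i j => by
    rw [pd, fderiv_of_notMem_tsupport ℝ hx']
    simp
  ext i
  fin_cases i <;> simp [curl, h]

/-- The cell averages of the limits are linked by the weak curl: only non-oscillating test fields
are used. -/
lemma hasWeakCurl_integral [IsFiniteMeasure (volume.restrict Ω)] {v c : ℕ → E3 → E3}
    (hvc : ∀ j, HasWeakCurl Ω (v j) (c j))
    {v₀ c₀ : E3 × T m → E3} (hv₀ : MemLp v₀ 2 (prodMeasure Ω m))
    (hc₀ : MemLp c₀ 2 (prodMeasure Ω m)) (hv : WeakTwoScaleVec Ω R η v v₀)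
    (hc : WeakTwoScaleVec Ω R η c c₀) :
    HasWeakCurl Ω (fun x => ∫ y, v₀ (x, y) ∂(cellMeasure m))
      (fun x => ∫ y, c₀ (x, y) ∂(cellMeasure m)) := by
  refine ⟨memLp_integral_right hv₀, memLp_integral_right hc₀, fun ψ hψ => ?_⟩
  have h1 := hv.tendsto_integral_inner (fun j => (hvc j).memLp) hv₀
    (hψ.memLp_curl (volume.restrict Ω)) 1
  have h2 := hc.tendsto_integral_inner (fun j => (hvc j).memLp_curl) hc₀
    (hψ.memLp (volume.restrict Ω) 2) 1
  simp only [ContinuousMap.one_apply, mul_one, fun j => (hvc j).integral_eq ψ hψ] at h1 h2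
  rw [← integral_inner_fst hv₀ (hψ.memLp_curl _), ← integral_inner_fst hc₀ (hψ.memLp _ _)]
  exact tendsto_nhds_unique h1 h2

/-- Testing `curl v_j = c_j` with `η_j ψ(x) Re(ζ e^{2πi k·Rx/η_j}) a`, only the derivative of the
oscillation survives in the limit. -/
lemma integral_cross_wave_eq_zero (hη : ∀ j, 0 < η j) (hη0 : Tendsto η atTop (𝓝 0))
    {v c : ℕ → E3 → E3} (hvc : ∀ j, HasWeakCurl Ω (v j) (c j))
    {v₀ c₀ : E3 × T m → E3} (hv₀ : MemLp v₀ 2 (prodMeasure Ω m))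
    (hc₀ : MemLp c₀ 2 (prodMeasure Ω m)) (hv : WeakTwoScaleVec Ω R η v v₀)
    (hc : WeakTwoScaleVec Ω R η c c₀) {ψ : E3 → ℝ} (hψ : IsTest Ω ψ) (k : Fin m → ℤ) (a : E3)
    (ζ : ℂ) :
    ∫ z, inner ℝ (v₀ z) (ψ z.1 • cross (wave R k) a) *
      trig k (2 * Real.pi * Complex.I * ζ) z.2 ∂(prodMeasure Ω m) = 0 := by
  have m1 : MemLp (fun x => ψ x • cross (wave R k) a) 2 (volume.restrict Ω) :=
    (hψ.smul_const _).memLp _ _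
  have m2 : MemLp (fun x => ψ x • a) 2 (volume.restrict Ω) := (hψ.smul_const _).memLp _ _
  have m3 : MemLp (fun x => cross (gradient ψ x) a) 2 (volume.restrict Ω) := by
    have h := (hψ.smul_const a).memLp_curl (volume.restrict Ω)
    have he : curl (fun x => ψ x • a) = fun x => cross (gradient ψ x) a :=
      funext fun x => curl_smul_const (hψ.1.differentiable (by simp) x) a
    rwa [he] at h
  have t1 := hv.tendsto_integral_inner (fun j => (hvc j).memLp) hv₀ m1
    (trig k (2 * Real.pi * Complex.I * ζ))
  have t2 := hc.tendsto_integral_inner (fun j => (hvc j).memLp_curl) hc₀ m2 (trig k ζ)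
  have t3 := hv.tendsto_integral_inner (fun j => (hvc j).memLp) hv₀ m3 (trig k ζ)
  have t4 := hη0.mul (t2.sub t3)
  rw [zero_mul] at t4
  refine tendsto_nhds_unique t1 (t4.congr fun j => ?_)
  have hj := (hvc j).integral_eq _
    ((hψ.mul_right (contDiff_trig_osc R (η j) k ζ)).smul_const a)
  have i1 := integrable_inner_mul (hvc j).memLp m1 (trig k (2 * Real.pi * Complex.I * ζ))
    (aestronglyMeasurable_osc Ω R (η j))
  have i3 := integrable_inner_mul (hvc j).memLp m3 (trig k ζ)
    (aestronglyMeasurable_osc Ω R (η j))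
  have e1 : ∀ x, inner ℝ (v j x) (curl (fun x => (ψ x * trig k ζ (osc R (η j) x)) • a) x) =
      inner ℝ (v j x) (cross (gradient ψ x) a) * trig k ζ (osc R (η j) x) +
      (η j)⁻¹ * (inner ℝ (v j x) (ψ x • cross (wave R k) a) *
        trig k (2 * Real.pi * Complex.I * ζ) (osc R (η j) x)) := fun x => by
    rw [curl_smul_const ((hψ.mul_right (contDiff_trig_osc R (η j) k ζ)).1.differentiable
        (by simp) x), gradient_mul_trig_osc R k ζ (hψ.1.differentiable (by simp) x)]
    simp only [cross_add_left, cross_smul_left, inner_add_right, inner_smul_right]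
    ring
  have e2 : ∀ x, inner ℝ (c j x) ((ψ x * trig k ζ (osc R (η j) x)) • a) =
      inner ℝ (c j x) (ψ x • a) * trig k ζ (osc R (η j) x) := fun x => by
    simp only [inner_smul_right]
    ring
  simp only [e1, e2] at hj
  rw [integral_add i3 (i1.const_mul _), integral_const_mul] at hj
  rw [← hj, add_sub_cancel_left, mul_inv_cancel_left₀ (hη j).ne']

/-- Testing `curl v_j = c_j` with the gradient of `η_j ψ(x) Re(ζ e^{2πi k·Rx/η_j})`, which is
curl-free. -/
lemma integral_wave_eq_zero (hη : ∀ j, 0 < η j) (hη0 : Tendsto η atTop (𝓝 0))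
    {v c : ℕ → E3 → E3} (hvc : ∀ j, HasWeakCurl Ω (v j) (c j)) {c₀ : E3 × T m → E3}
    (hc₀ : MemLp c₀ 2 (prodMeasure Ω m))
    (hc : WeakTwoScaleVec Ω R η c c₀) {ψ : E3 → ℝ} (hψ : IsTest Ω ψ) (k : Fin m → ℤ) (ζ : ℂ) :
    ∫ z, inner ℝ (c₀ z) (ψ z.1 • wave R k) *
      trig k (2 * Real.pi * Complex.I * ζ) z.2 ∂(prodMeasure Ω m) = 0 := by
  have m1 : MemLp (fun x => ψ x • wave R k) 2 (volume.restrict Ω) :=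
    (hψ.smul_const _).memLp _ _
  have m2 : MemLp (gradient ψ) 2 (volume.restrict Ω) := hψ.gradient.memLp _ _
  have t1 := hc.tendsto_integral_inner (fun j => (hvc j).memLp_curl) hc₀ m1
    (trig k (2 * Real.pi * Complex.I * ζ))
  have t2 := hc.tendsto_integral_inner (fun j => (hvc j).memLp_curl) hc₀ m2 (trig k ζ)
  have t4 := hη0.mul t2.neg
  rw [zero_mul] at t4
  refine tendsto_nhds_unique t1 (t4.congr fun j => ?_)
  have hf := hψ.mul_right (contDiff_trig_osc R (η j) k ζ)
  have hj := (hvc j).integral_eq _ hf.gradient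
  have i1 := integrable_inner_mul (hvc j).memLp_curl m1 (trig k (2 * Real.pi * Complex.I * ζ))
    (aestronglyMeasurable_osc Ω R (η j))
  have i2 := integrable_inner_mul (hvc j).memLp_curl m2 (trig k ζ)
    (aestronglyMeasurable_osc Ω R (η j))
  have e1 : ∀ x, inner ℝ (c j x) (gradient (fun x => ψ x * trig k ζ (osc R (η j) x)) x) =
      inner ℝ (c j x) (gradient ψ x) * trig k ζ (osc R (η j) x) +
      (η j)⁻¹ * (inner ℝ (c j x) (ψ x • wave R k) *
        trig k (2 * Real.pi * Complex.I * ζ) (osc R (η j) x)) := fun x => by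
    rw [gradient_mul_trig_osc R k ζ (hψ.1.differentiable (by simp) x)]
    simp only [inner_add_right, inner_smul_right]
    ring
  simp only [e1, curl_gradient (mod_cast contDiff_infty.1 hf.1 2), inner_zero_right,
    integral_zero] at hj
  rw [integral_add i2 (i1.const_mul _), integral_const_mul] at hj
  rw [← eq_neg_of_add_eq_zero_right hj.symm, mul_inv_cancel_left₀ (hη j).ne']

end Limits

/-! ### Fourier coefficients of vector fields on the torus -/

section Fourier

variable {m : ℕ}

lemma coeff_apply (w : T m → E3) (k : Fin m → ℤ) (i : Fin 3) :
    coeff w k i = ∫ y, UnitAddTorus.mFourier (-k) y * ((w y i : ℝ) : ℂ) ∂(cellMeasure m) := rfl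

lemma coeff_neg (w : T m → E3) (k : Fin m → ℤ) : coeff w (-k) = star (coeff w k) := by
  ext i
  rw [Pi.star_apply, coeff_apply, coeff_apply, ← starRingEnd_apply, ← integral_conj]
  refine integral_congr_ae (Eventually.of_forall fun y => ?_)
  simp [UnitAddTorus.mFourier_neg]

lemma coeff_zero_apply (w : T m → E3) (i : Fin 3) :
    coeff w 0 i = ((∫ y, w y i ∂(cellMeasure m) : ℝ) : ℂ) := by
  rw [coeff_apply, ← integral_complex_ofReal]
  simp [UnitAddTorus.mFourier_zero]

lemma integrable_mFourier_mul {f : T m → ℂ} (hf : Integrable f (cellMeasure m))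
    (k : Fin m → ℤ) : Integrable (fun y => UnitAddTorus.mFourier k y * f y) (cellMeasure m) :=
  hf.bdd_mul (c := ‖UnitAddTorus.mFourier k‖)
    (UnitAddTorus.mFourier k).continuous.aestronglyMeasurable
    (Eventually.of_forall fun y => (UnitAddTorus.mFourier k).norm_coe_le_norm y)

/-- Removing the average kills the coefficient of index `0` and leaves the others unchanged. -/
lemma coeff_sub_integral {w : T m → E3} (hw : MemLp w 2 (cellMeasure m)) (k : Fin m → ℤ) :
    coeff (fun y => w y - ∫ y', w y' ∂(cellMeasure m)) k = if k = 0 then 0 else coeff w k := by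
  have hwi : ∀ i, Integrable (fun y => w y i) (cellMeasure m) := fun i =>
    (hw.eval_piLp i).integrable one_le_two
  ext i
  have h : coeff (fun y => w y - ∫ y', w y' ∂(cellMeasure m)) k i =
      coeff w k i - (∫ y, UnitAddTorus.mFourier (-k) y ∂(cellMeasure m)) *
        (((∫ y', w y' ∂(cellMeasure m)) i : ℝ) : ℂ) := by
    rw [coeff_apply, coeff_apply, ← integral_mul_const, ← integral_sub]
    · refine integral_congr_ae (Eventually.of_forall fun y => ?_)
      simp [mul_sub]
    · exact integrable_mFourier_mul (hwi i).ofReal _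
    · exact integrable_mFourier_mul (integrable_const _) _
  rw [h, eval_integral_piLp hwi]
  split_ifs with hk
  · subst hk
    rw [coeff_zero_apply]
    simp [UnitAddTorus.mFourier_zero]
  · rw [integral_mFourier_of_ne_zero (neg_ne_zero.2 hk), zero_mul, sub_zero]

lemma hasSum_conj_coeff_mul_coeff {w g : T m → E3} (hw : MemLp w 2 (cellMeasure m))
    (hg : MemLp g 2 (cellMeasure m)) (i j : Fin 3) :
    HasSum (fun k => star (coeff w k i) * coeff g k j)
      ((∫ y, w y i * g y j ∂(cellMeasure m) : ℝ) : ℂ) := by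
  have h1 : MemLp (fun y => ((w y i : ℝ) : ℂ)) 2 (cellMeasure m) := (hw.eval_piLp i).ofReal
  have h2 : MemLp (fun y => ((g y j : ℝ) : ℂ)) 2 (cellMeasure m) := (hg.eval_piLp j).ofReal
  have h := UnitAddTorus.hasSum_prod_mFourierCoeff (h1.toLp _) (h2.toLp _)
  convert! h using 1
  · ext k
    congr 1
    · congr 1
      exact (integral_congr_ae (h1.coeFn_toLp.mono fun y hy => by simp only [hy])).symm
    · exact (integral_congr_ae (h2.coeFn_toLp.mono fun y hy => by simp only [hy])).symm
  · rw [← integral_complex_ofReal]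
    refine integral_congr_ae ?_
    filter_upwards [h1.coeFn_toLp, h2.coeFn_toLp] with y hy1 hy2
    rw [hy1, hy2]
    simp

lemma freq_zero (R : Matrix (Fin m) (Fin 3) ℝ) : freq R 0 = 0 := by
  ext i
  simp [freq, Matrix.mulVec, dotProduct]

lemma freq_eq_zero_iff {R : Matrix (Fin m) (Fin 3) ℝ} (hR : Irrational R) {k : Fin m → ℤ} :
    freq R k = 0 ↔ k = 0 := by
  constructor
  · intro h
    by_contra hk
    refine hR k hk (funext fun i => ?_)
    simpa [freq] using congrFun h i
  · rintro rfl
    exact freq_zero R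

lemma curlRFree_iff {R : Matrix (Fin m) (Fin 3) ℝ} {w : T m → E3} :
    CurlRFree R w ↔ MemLp w 2 (cellMeasure m) ∧
      ∀ k, crossProduct (freq R k) (coeff w k) = 0 := by
  refine and_congr_right fun _ => forall_congr' fun k => ?_
  have h0 : coeff (0 : T m → E3) k = 0 := by
    ext i
    simp [coeff_apply]
  have hpi : (2 * Real.pi * Complex.I : ℂ) ≠ 0 := by simp [Real.pi_ne_zero]
  rw [h0, eq_comm, smul_eq_zero, or_iff_right hpi]

/-- The coefficients of a `curl_R`-free field are parallel to `Rᵀk`, so those of two such fields are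
parallel to the same real vector: their componentwise Parseval products are symmetric for `k ≠ 0`. -/
lemma CurlRFree.integral_mul_sub {R : Matrix (Fin m) (Fin 3) ℝ} (hR : Irrational R)
    {w g : T m → E3} (hw : CurlRFree R w) (hg : CurlRFree R g) (i j : Fin 3) :
    (∫ y, w y i * g y j ∂(cellMeasure m)) - ∫ y, w y j * g y i ∂(cellMeasure m) =
      (∫ y, w y i ∂(cellMeasure m)) * (∫ y, g y j ∂(cellMeasure m)) -
        (∫ y, w y j ∂(cellMeasure m)) * ∫ y, g y i ∂(cellMeasure m) := by
  have hS := (hasSum_conj_coeff_mul_coeff hw.1 hg.1 i j).sub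
    (hasSum_conj_coeff_mul_coeff hw.1 hg.1 j i)
  have hpar : ∀ (v : T m → E3), CurlRFree R v → ∀ k a b,
      freq R k a * coeff v k b = freq R k b * coeff v k a := fun v hv k a b => by
    have h := (curlRFree_iff.1 hv).2 k
    rw [cross_apply] at h
    have h0 := congrFun h 0
    have h1 := congrFun h 1
    have h2 := congrFun h 2
    simp only [Matrix.cons_val, Pi.zero_apply, sub_eq_zero] at h0 h1 h2
    fin_cases a <;> fin_cases b <;> simp [h0, h1, h2]
  -- For `k ≠ 0` some component `l` of `Rᵀk` is nonzero; both coefficients are multiples of `Rᵀk`.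
  have hz : ∀ k, k ≠ 0 →
      star (coeff w k i) * coeff g k j - star (coeff w k j) * coeff g k i = 0 := fun k hk => by
    obtain ⟨l, hl⟩ := Function.ne_iff.1 (mt (freq_eq_zero_iff hR).1 hk)
    have hl : freq R k l ≠ 0 := hl
    have hreal : ∀ a, star (freq R k a) = freq R k a := fun a => Complex.conj_ofReal _
    have hstar : ∀ a b, freq R k a * star (coeff w k b) = freq R k b * star (coeff w k a) :=
      fun a b => by
        have := congrArg star (hpar w hw k a b)
        simpa only [star_mul', hreal] using this
    have h1 := hstar l i
    have h2 := hstar l j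
    have h3 := hpar g hg k l i
    have h4 := hpar g hg k l j
    refine (mul_eq_zero.1 (?_ : freq R k l ^ 2 * _ = 0)).resolve_left (pow_ne_zero 2 hl)
    linear_combination (freq R k l * coeff g k j) * h1 - (freq R k l * coeff g k i) * h2
      + (freq R k i * star (coeff w k l)) * h4 - (freq R k j * star (coeff w k l)) * h3
  have h0 := hS.unique (hasSum_single 0 hz)
  simp only [coeff_zero_apply, Complex.star_def, Complex.conj_ofReal] at h0
  exact_mod_cast h0

lemma inner_cross (a b c : E3) :
    inner ℝ a (cross b c) = b 0 * (c 1 * a 2 - c 2 * a 1) + b 1 * (c 2 * a 0 - c 0 * a 2)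
      + b 2 * (c 0 * a 1 - c 1 * a 0) := by
  simp [PiLp.inner_apply, Fin.sum_univ_three, cross, cross_apply]
  ring

/-- The oscillating parts of two `curl_R`-free fields do not contribute to the triple product. -/
lemma CurlRFree.integral_inner_cross {R : Matrix (Fin m) (Fin 3) ℝ} (hR : Irrational R)
    {w g : T m → E3} (hw : CurlRFree R w) (hg : CurlRFree R g) (b : E3) :
    ∫ y, inner ℝ (w y) (cross b (g y)) ∂(cellMeasure m) =
      inner ℝ (∫ y, w y ∂(cellMeasure m)) (cross b (∫ y, g y ∂(cellMeasure m))) := by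
  have hi : ∀ i j, Integrable (fun y => g y i * w y j) (cellMeasure m) := fun i j =>
    (hg.1.eval_piLp i).integrable_mul (hw.1.eval_piLp j)
  have hd : ∀ (r : ℝ) i j, Integrable (fun y => r * (g y i * w y j - g y j * w y i))
      (cellMeasure m) := fun r i j => ((hi i j).sub (hi j i)).const_mul r
  have hs : ∀ (r : ℝ) i j, ∫ y, r * (g y i * w y j - g y j * w y i) ∂(cellMeasure m) =
      r * ((∫ y, g y i ∂(cellMeasure m)) * (∫ y, w y j ∂(cellMeasure m)) -
        (∫ y, g y j ∂(cellMeasure m)) * ∫ y, w y i ∂(cellMeasure m)) := fun r i j => by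
    rw [integral_const_mul, integral_sub (hi i j) (hi j i), hg.integral_mul_sub hR hw]
  have h01 : Integrable (fun y => b 0 * (g y 1 * w y 2 - g y 2 * w y 1) +
      b 1 * (g y 2 * w y 0 - g y 0 * w y 2)) (cellMeasure m) := (hd _ _ _).add (hd _ _ _)
  simp only [inner_cross]
  rw [integral_add h01 (hd _ _ _), integral_add (hd _ _ _) (hd _ _ _),
    hs, hs, hs,
    eval_integral_piLp fun i => (hw.1.eval_piLp i).integrable one_le_two,
    eval_integral_piLp fun i => (hw.1.eval_piLp i).integrable one_le_two,
    eval_integral_piLp fun i => (hw.1.eval_piLp i).integrable one_le_two,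
    eval_integral_piLp fun i => (hg.1.eval_piLp i).integrable one_le_two,
    eval_integral_piLp fun i => (hg.1.eval_piLp i).integrable one_le_two,
    eval_integral_piLp fun i => (hg.1.eval_piLp i).integrable one_le_two]

lemma curlRFree_const {R : Matrix (Fin m) (Fin 3) ℝ} (a : E3) :
    CurlRFree R (fun _ : T m => a) := by
  refine curlRFree_iff.2 ⟨memLp_const a, fun k => ?_⟩
  rcases eq_or_ne k 0 with rfl | hk
  · simp [freq_zero]
  · have : coeff (fun _ : T m => a) k = 0 := by
      ext i
      rw [coeff_apply, integral_mul_const, integral_mFourier_of_ne_zero (neg_ne_zero.2 hk)]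
      simp
    simp [this]

end Fourier

section FieldCoefficients

variable {m : ℕ} {Ω : Set E3}

lemma aestronglyMeasurable_coeff {v : E3 × T m → E3}
    (hv : AEStronglyMeasurable v (prodMeasure Ω m)) (k : Fin m → ℤ) :
    AEStronglyMeasurable (fun x => coeff (fun y => v (x, y)) k) (volume.restrict Ω) := by
  refine (aemeasurable_pi_lambda _ fun i => ?_).aestronglyMeasurable
  have h : AEStronglyMeasurable (fun z : E3 × T m =>
      UnitAddTorus.mFourier (-k) z.2 * ((v z i : ℝ) : ℂ)) (prodMeasure Ω m) := by
    refine ((UnitAddTorus.mFourier (-k)).continuous.comp_aestronglyMeasurable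
      (aestronglyMeasurable_snd_cell Ω m)).mul ?_
    exact (Complex.continuous_ofReal.comp
      (EuclideanSpace.proj i : E3 →L[ℝ] ℝ).continuous).comp_aestronglyMeasurable hv
  exact h.integral_prod_right'.aemeasurable

/-- A linear relation between Fourier coefficients, in weak form on `Ω`, holds almost everywhere. -/
lemma ae_sum_mul_coeff_eq_zero (hΩ : IsOpen Ω) [IsFiniteMeasure (volume.restrict Ω)]
    {v : E3 × T m → E3} (hv : MemLp v 2 (prodMeasure Ω m)) (k : Fin m → ℤ) (b : E3)
    (h : ∀ ψ : E3 → ℝ, IsTest Ω ψ → ∀ ζ : ℂ,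
      ∫ z, inner ℝ (v z) (ψ z.1 • b) * trig (-k) (2 * Real.pi * Complex.I * ζ) z.2
        ∂(prodMeasure Ω m) = 0) :
    ∀ᵐ x ∂(volume.restrict Ω), ∑ i, ((b i : ℝ) : ℂ) * coeff (fun y => v (x, y)) k i = 0 := by
  have hint : ∀ ζ, Integrable (fun z => inner ℝ (v z) b * trig (-k) ζ z.2) (prodMeasure Ω m) :=
    fun ζ => integrable_inner_mul hv (memLp_const b) _ (aestronglyMeasurable_snd_cell Ω m)
  have hae : ∀ ζ : ℂ, ∀ᵐ x ∂(volume.restrict Ω),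
      ∫ y, inner ℝ (v (x, y)) b * trig (-k) ζ y ∂(cellMeasure m) = 0 := fun ζ => by
    rw [ae_restrict_iff' hΩ.measurableSet]
    have hi : Integrable (fun x => ∫ y, inner ℝ (v (x, y)) b * trig (-k) ζ y ∂(cellMeasure m))
      (volume.restrict Ω) := (hint ζ).integral_prod_left
    refine hΩ.ae_eq_zero_of_integral_contDiff_smul_eq_zero
      (IntegrableOn.locallyIntegrableOn hi) fun ψ h1 h2 h3 => ?_
    have hψ : IsTest Ω ψ := ⟨h1, h2, h3⟩
    rw [← setIntegral_eq_integral_of_forall_compl_eq_zero (s := Ω)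
      (fun x hx => by rw [image_eq_zero_of_notMem_tsupport fun hx' => hx (h3 hx'), zero_smul])]
    have hpi : (2 * Real.pi * Complex.I : ℂ) ≠ 0 := by simp [Real.pi_ne_zero]
    have hz := h ψ hψ ((2 * Real.pi * Complex.I)⁻¹ * ζ)
    have hψb : MemLp (fun z : E3 × T m => ψ z.1 • b) 2 (prodMeasure Ω m) :=
      ((hψ.smul_const b).memLp (volume.restrict Ω) 2).comp_measurePreserving
        (measurePreserving_fst_cell Ω m)
    rw [mul_inv_cancel_left₀ hpi, integral_prod _ (integrable_inner_mul hv hψb _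
      (aestronglyMeasurable_snd_cell Ω m))] at hz
    rw [← hz]
    refine integral_congr_ae (Eventually.of_forall fun x => ?_)
    simp only [smul_eq_mul, inner_smul_right, mul_assoc]
    rw [integral_const_mul]
  -- `ζ = 1` and `ζ = -i` give the real and the imaginary part of the coefficient.
  filter_upwards [hae 1, hae (-Complex.I), ae_memLp_slice hv] with x h1 h2 hx
  have hs : ∑ i, ((b i : ℝ) : ℂ) * coeff (fun y => v (x, y)) k i =
      ∫ y, UnitAddTorus.mFourier (-k) y * ((inner ℝ (v (x, y)) b : ℝ) : ℂ) ∂(cellMeasure m) := by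
    simp only [coeff_apply, ← integral_const_mul]
    rw [← integral_finsetSum]
    · refine integral_congr_ae (Eventually.of_forall fun y => ?_)
      simp only [PiLp.inner_apply, Complex.ofReal_sum, Finset.mul_sum]
      refine Finset.sum_congr rfl fun i _ => ?_
      simp
      ring
    · intro i _
      exact (integrable_mFourier_mul ((hx.eval_piLp i).integrable one_le_two).ofReal _).const_mul _
  have hI : Integrable (fun y => UnitAddTorus.mFourier (-k) y *
      ((inner ℝ (v (x, y)) b : ℝ) : ℂ)) (cellMeasure m) :=
    integrable_mFourier_mul ((hx.inner_const b).integrable one_le_two).ofReal _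
  rw [hs]
  refine Complex.ext ?_ ?_
  · refine (integral_re hI).symm.trans (Eq.trans ?_ h1)
    refine integral_congr_ae (Eventually.of_forall fun y => ?_)
    simp [trig_apply, mul_comm]
  · refine (integral_im hI).symm.trans (Eq.trans ?_ h2)
    refine integral_congr_ae (Eventually.of_forall fun y => ?_)
    simp [trig_apply, mul_comm]

end FieldCoefficients

/-! ### Structure of the limits -/

section Structure

variable {m : ℕ} {Ω : Set E3} {R : Matrix (Fin m) (Fin 3) ℝ}

lemma wave_apply (R : Matrix (Fin m) (Fin 3) ℝ) (k : Fin m → ℤ) (i : Fin 3) :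
    ((wave R k i : ℝ) : ℂ) = freq R k i := rfl

lemma freq_neg (R : Matrix (Fin m) (Fin 3) ℝ) (k : Fin m → ℤ) : freq R (-k) = -freq R k := by
  ext i
  simp [freq, Matrix.mulVec, dotProduct]

lemma star_freq (R : Matrix (Fin m) (Fin 3) ℝ) (k : Fin m → ℤ) : star (freq R k) = freq R k :=
  funext fun _ => Complex.conj_ofReal _

lemma star_dotProduct_eq (v w : Fin 3 → ℂ) : star (v ⬝ᵥ w) = star v ⬝ᵥ star w := by
  simp [dotProduct]

lemma freq_dotProduct_self_ne_zero (hR : Irrational R) {k : Fin m → ℤ} (hk : k ≠ 0) :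
    freq R k ⬝ᵥ freq R k ≠ 0 := by
  have h : freq R k ⬝ᵥ freq R k = (((wave R k).ofLp ⬝ᵥ (wave R k).ofLp : ℝ) : ℂ) := by
    simp [dotProduct, wave_apply]
  rw [h, Complex.ofReal_ne_zero, Ne, dotProduct_self_eq_zero]
  exact hR k hk

lemma eq_smul_of_crossProduct_eq_zero {r w : Fin 3 → ℂ} (hr : r ⬝ᵥ r ≠ 0)
    (h : crossProduct r w = 0) : w = ((r ⬝ᵥ w) / (r ⬝ᵥ r)) • r := by
  rw [cross_apply] at h
  have h0 := congrFun h 0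
  have h1 := congrFun h 1
  have h2 := congrFun h 2
  simp only [Matrix.cons_val, Pi.zero_apply] at h0 h1 h2
  ext i
  rw [Pi.smul_apply, smul_eq_mul, div_mul_eq_mul_div, eq_div_iff hr]
  simp only [dotProduct, Fin.sum_univ_three]
  fin_cases i <;> simp only [Fin.zero_eta, Fin.mk_one, Fin.reduceFinMk]
  · linear_combination r 2 * h1 - r 1 * h2
  · linear_combination r 0 * h2 - r 2 * h0
  · linear_combination r 1 * h0 - r 0 * h1

lemma crossProduct_crossProduct_of_dotProduct_eq_zero {r w : Fin 3 → ℂ} (h : r ⬝ᵥ w = 0) :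
    crossProduct r (crossProduct r w) = -(r ⬝ᵥ r) • w := by
  simp only [dotProduct, Fin.sum_univ_three] at h
  ext i
  simp only [cross_apply, dotProduct, Fin.sum_univ_three]
  fin_cases i <;> simp
  · linear_combination r 0 * h
  · linear_combination r 1 * h
  · linear_combination r 2 * h

/-- If the weak form of `Rᵀk × v̂(k) = 0` holds then almost every slice of `v` is `curl_R`-free. -/
lemma memL2CurlRFree_of_integral (hΩ : IsOpen Ω) [IsFiniteMeasure (volume.restrict Ω)]
    {v : E3 × T m → E3} (hv : MemLp v 2 (prodMeasure Ω m))
    (h : ∀ ψ : E3 → ℝ, IsTest Ω ψ → ∀ (k : Fin m → ℤ) (a : E3) (ζ : ℂ),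
      ∫ z, inner ℝ (v z) (ψ z.1 • cross (wave R k) a) *
        trig k (2 * Real.pi * Complex.I * ζ) z.2 ∂(prodMeasure Ω m) = 0) :
    MemL2CurlRFree Ω R v := by
  refine ⟨hv, ?_⟩
  have hk : ∀ᵐ x ∂(volume.restrict Ω), ∀ (k : Fin m → ℤ) (l : Fin 3),
      ∑ i, ((cross (wave R (-k)) (EuclideanSpace.single l 1) i : ℝ) : ℂ) *
        coeff (fun y => v (x, y)) k i = 0 :=
    ae_all_iff.2 fun k => ae_all_iff.2 fun l =>
      ae_sum_mul_coeff_eq_zero hΩ hv k _ fun ψ hψ ζ => h ψ hψ (-k) _ ζ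
  filter_upwards [ae_memLp_slice hv, hk] with x hx hxk
  refine curlRFree_iff.2 ⟨hx, fun k => ?_⟩
  have h0 := hxk k 0
  have h1 := hxk k 1
  have h2 := hxk k 2
  simp [Fin.sum_univ_three, cross, cross_apply, wave_apply, freq_neg] at h0 h1 h2
  rw [cross_apply]
  ext i
  fin_cases i <;> simp
  · linear_combination h0
  · linear_combination h1
  · linear_combination h2

lemma ae_dotProduct_coeff_eq_zero (hΩ : IsOpen Ω) [IsFiniteMeasure (volume.restrict Ω)]
    {v : E3 × T m → E3} (hv : MemLp v 2 (prodMeasure Ω m))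
    (h : ∀ ψ : E3 → ℝ, IsTest Ω ψ → ∀ (k : Fin m → ℤ) (ζ : ℂ),
      ∫ z, inner ℝ (v z) (ψ z.1 • wave R k) *
        trig k (2 * Real.pi * Complex.I * ζ) z.2 ∂(prodMeasure Ω m) = 0) :
    ∀ᵐ x ∂(volume.restrict Ω), ∀ k : Fin m → ℤ,
      freq R k ⬝ᵥ coeff (fun y => v (x, y)) k = 0 := by
  refine ae_all_iff.2 fun k => ?_
  filter_upwards [ae_sum_mul_coeff_eq_zero hΩ hv k (wave R (-k))
    fun ψ hψ ζ => h ψ hψ (-k) ζ] with x hx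
  simp only [wave_apply, freq_neg] at hx
  have : -(freq R k) ⬝ᵥ coeff (fun y => v (x, y)) k = 0 := hx
  rwa [neg_dotProduct, neg_eq_zero] at this

lemma memLp_sub_integral [IsFiniteMeasure (volume.restrict Ω)] {v : E3 × T m → E3}
    (hv : MemLp v 2 (prodMeasure Ω m)) :
    MemLp (fun z => v z - ∫ y, v (z.1, y) ∂(cellMeasure m)) 2 (prodMeasure Ω m) :=
  hv.sub ((memLp_integral_right hv).comp_measurePreserving (measurePreserving_fst_cell Ω m))

/-- The oscillating part of a field with `curl_R`-free slices is a `grad_R`: the potential has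
coefficients `Rᵀk · v̂(k) / (2πi |Rᵀk|²)`, which are `0` at `k = 0` by the convention `x / 0 = 0`. -/
lemma MemL2CurlRFree.isGradRField (hR : Irrational R) [IsFiniteMeasure (volume.restrict Ω)]
    {v : E3 × T m → E3} (hv : MemL2CurlRFree Ω R v) :
    IsGradRField Ω R
      (fun x k => (freq R k ⬝ᵥ coeff (fun y => v (x, y)) k) /
        (2 * Real.pi * Complex.I * (freq R k ⬝ᵥ freq R k)))
      (fun z => v z - ∫ y, v (z.1, y) ∂(cellMeasure m)) where
  memLp := memLp_sub_integral hv.1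
  measurable_coeff k := by
    have hc : Continuous fun w : Fin 3 → ℂ =>
        (freq R k ⬝ᵥ w) / (2 * Real.pi * Complex.I * (freq R k ⬝ᵥ freq R k)) := by
      unfold dotProduct
      fun_prop
    exact hc.comp_aestronglyMeasurable (aestronglyMeasurable_coeff hv.1.1 k)
  real := Eventually.of_forall fun x k => by
    rw [coeff_neg, freq_neg, star_div₀]
    simp only [star_mul', star_dotProduct_eq, star_freq, neg_dotProduct]
    simp [neg_div, div_neg]
  grad_eq := by
    filter_upwards [hv.2] with x hx k
    have h := coeff_sub_integral hx.1 k
    refine h.trans ?_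
    split_ifs with hk
    · simp [hk, freq_zero]
    · refine (eq_smul_of_crossProduct_eq_zero (freq_dotProduct_self_ne_zero hR hk)
        ((curlRFree_iff.1 hx).2 k)).trans ?_
      have hpi : (2 * Real.pi * Complex.I : ℂ) ≠ 0 := by simp [Real.pi_ne_zero]
      rw [mul_div_assoc', mul_div_mul_left _ _ hpi]

/-- The oscillating part of a field whose coefficients are orthogonal to `Rᵀk` is a `curl_R`: the
potential has coefficients `-Rᵀk × v̂(k) / (2πi |Rᵀk|²)`, which are `0` at `k = 0` by the
convention `0⁻¹ = 0`. -/
lemma isCurlRField_of_dotProduct_coeff (hR : Irrational R) [IsFiniteMeasure (volume.restrict Ω)]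
    {v : E3 × T m → E3} (hv : MemLp v 2 (prodMeasure Ω m))
    (h : ∀ᵐ x ∂(volume.restrict Ω), ∀ k : Fin m → ℤ,
      freq R k ⬝ᵥ coeff (fun y => v (x, y)) k = 0) :
    IsCurlRField Ω R
      (fun x k => -(2 * Real.pi * Complex.I * (freq R k ⬝ᵥ freq R k))⁻¹ •
        crossProduct (freq R k) (coeff (fun y => v (x, y)) k))
      (fun z => v z - ∫ y, v (z.1, y) ∂(cellMeasure m)) where
  memLp := memLp_sub_integral hv
  measurable_coeff k := by
    have hc : Continuous fun w : Fin 3 → ℂ =>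
        -(2 * Real.pi * Complex.I * (freq R k ⬝ᵥ freq R k))⁻¹ • crossProduct (freq R k) w := by
      have h0 : Continuous fun w => crossProduct (freq R k) w :=
        LinearMap.continuous_of_finiteDimensional _
      fun_prop
    exact hc.comp_aestronglyMeasurable (aestronglyMeasurable_coeff hv.1 k)
  real := Eventually.of_forall fun x k => by
    have hs : ∀ a b : Fin 3 → ℂ, star (crossProduct a b) = crossProduct (star a) (star b) :=
      fun a b => by
        ext i
        fin_cases i <;> simp [cross_apply]
    rw [coeff_neg, freq_neg, star_smul, hs, star_freq]
    simp only [star_neg, star_inv₀, star_mul', star_dotProduct_eq, star_freq, neg_dotProduct_neg,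
      map_neg, LinearMap.neg_apply]
    simp [-cross_anticomm]
  curl_eq := by
    filter_upwards [ae_memLp_slice hv, h] with x hx hd k
    refine (coeff_sub_integral hx k).trans ?_
    split_ifs with hk
    · simp [hk, freq_zero]
    · have hpi : (2 * Real.pi * Complex.I : ℂ) ≠ 0 := by simp [Real.pi_ne_zero]
      have hr := freq_dotProduct_self_ne_zero hR hk
      rw [map_smul, crossProduct_crossProduct_of_dotProduct_eq_zero (hd k), smul_smul, smul_smul]
      rw [show 2 * Real.pi * Complex.I * -(2 * Real.pi * Complex.I * (freq R k ⬝ᵥ freq R k))⁻¹ *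
        -(freq R k ⬝ᵥ freq R k) = 1 by field_simp, one_smul]

lemma continuous_cross : Continuous fun p : E3 × E3 => cross p.1 p.2 := by
  refine (PiLp.continuous_toLp 2 _).comp (continuous_pi fun i => ?_)
  fin_cases i <;> simp only [cross_apply] <;> simp <;> fun_prop

lemma norm_cross_le (a b : E3) : ‖cross a b‖ ≤ ‖a‖ * ‖b‖ := by
  refine le_of_sq_le_sq ?_ (by positivity)
  rw [mul_pow, EuclideanSpace.real_norm_sq_eq, EuclideanSpace.real_norm_sq_eq,
    EuclideanSpace.real_norm_sq_eq]
  simp [Fin.sum_univ_three, cross, cross_apply]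
  nlinarith [sq_nonneg (a 0 * b 0 + a 1 * b 1 + a 2 * b 2)]

/-- A field with `curl_R`-free slices whose cell average `u` has a weak curl is in `H(curl, Ω; X)`:
its curl is that of `u`, because the triple product with a `curl_R`-free field only sees the
averages. -/
lemma MemL2CurlRFree.memHcurlX (hR : Irrational R) [IsFiniteMeasure (volume.restrict Ω)]
    {v : E3 × T m → E3} (hv : MemL2CurlRFree Ω R v) {c : E3 → E3}
    (hc : HasWeakCurl Ω (fun x => ∫ y, v (x, y) ∂(cellMeasure m)) c) : MemHcurlX Ω R v := by
  have hc2 : MemLp (fun z : E3 × T m => c z.1) 2 (prodMeasure Ω m) :=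
    hc.memLp_curl.comp_measurePreserving (measurePreserving_fst_cell Ω m)
  refine ⟨hv, fun z => c z.1, ⟨hc2, Eventually.of_forall fun x => curlRFree_const (c x)⟩,
    fun ψ g hψ hg => ?_⟩
  have hg2 : MemLp (fun z : E3 × T m => g z.2) 2 (prodMeasure Ω m) := hg.1.comp_snd _
  obtain ⟨C1, hC1⟩ := hψ.gradient.1.continuous.bounded_above_of_compact_support hψ.gradient.2.1
  obtain ⟨C2, hC2⟩ := hψ.1.continuous.bounded_above_of_compact_support hψ.2.1
  have h1 : MemLp (fun z : E3 × T m => cross (gradient ψ z.1) (g z.2)) 2 (prodMeasure Ω m) := by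
    have hgrad : AEStronglyMeasurable (fun z : E3 × T m => gradient ψ z.1) (prodMeasure Ω m) :=
      (hψ.gradient.1.continuous.comp continuous_fst).aestronglyMeasurable
    have hm := continuous_cross.comp_aestronglyMeasurable (hgrad.prodMk hg2.1)
    refine hg2.of_le_mul (c := C1) hm (Eventually.of_forall fun z => (norm_cross_le _ _).trans ?_)
    exact mul_le_mul_of_nonneg_right (hC1 _) (norm_nonneg _)
  have h2 : MemLp (fun z : E3 × T m => ψ z.1 • g z.2) 2 (prodMeasure Ω m) := by
    have hψm : AEStronglyMeasurable (fun z : E3 × T m => ψ z.1) (prodMeasure Ω m) :=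
      (hψ.1.continuous.comp continuous_fst).aestronglyMeasurable
    refine hg2.of_le_mul (c := C2) (hψm.smul hg2.1) (Eventually.of_forall fun z => ?_)
    rw [norm_smul]
    exact mul_le_mul_of_nonneg_right (hC2 _) (norm_nonneg _)
  rw [integral_prod _ (integrable_inner_of_memLp hv.1 h1),
    integral_prod _ (integrable_inner_of_memLp hc2 h2)]
  have h := hc.integral_eq _ (hψ.smul_const (∫ y, g y ∂(cellMeasure m)))
  simp only [fun x => curl_smul_const (hψ.1.differentiable (by simp) x)] at h
  refine Eq.trans (integral_congr_ae ?_) (h.trans (integral_congr_ae ?_))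
  · filter_upwards [hv.2] with x hx
    exact hx.integral_inner_cross hR hg _
  · refine Eventually.of_forall fun x => ?_
    have hgi := hg.1.integrable one_le_two
    simp only
    rw [← integral_smul]
    exact (integral_inner (hgi.smul (ψ x)) (c x)).symm

end Structure

end QuasiTwoScale

end

theorem mainTheorem6 {m : ℕ} (hm : 3 < m) (R : Matrix (Fin m) (Fin 3) ℝ)
    (hR : QuasiTwoScale.Irrational R)
    (Ω : Set QuasiTwoScale.E3) (hΩ : IsOpen Ω) (hΩb : Bornology.IsBounded Ω)
    (η : ℕ → ℝ) (hη : ∀ j, 0 < η j) (hη0 : Tendsto η atTop (𝓝 0))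
    (uη curlη : ℕ → QuasiTwoScale.E3 → QuasiTwoScale.E3)
    (hu : ∀ j, QuasiTwoScale.HasWeakCurl Ω (uη j) (curlη j))
    (C : ℝ)
    (hbdd : ∀ j, eLpNorm (uη j) 2 (volume.restrict Ω) + eLpNorm (curlη j) 2 (volume.restrict Ω)
      ≤ ENNReal.ofReal C) :
    ∃ (s : ℕ → ℕ) (u₀ gradφ curlu₁ : QuasiTwoScale.E3 × QuasiTwoScale.T m → QuasiTwoScale.E3)
      (u curlu : QuasiTwoScale.E3 → QuasiTwoScale.E3)
      (φ : QuasiTwoScale.E3 → (Fin m → ℤ) → ℂ)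
      (u₁ : QuasiTwoScale.E3 → (Fin m → ℤ) → Fin 3 → ℂ),
      StrictMono s ∧
      QuasiTwoScale.MemHcurlX Ω R u₀ ∧
      QuasiTwoScale.IsGradRField Ω R φ gradφ ∧
      QuasiTwoScale.IsCurlRField Ω R u₁ curlu₁ ∧
      (∀ᵐ x ∂(volume.restrict Ω), u x = ∫ y, u₀ (x, y) ∂(QuasiTwoScale.cellMeasure m)) ∧
      QuasiTwoScale.HasWeakCurl Ω u curlu ∧
      (∀ᵐ z ∂(QuasiTwoScale.prodMeasure Ω m), u₀ z = u z.1 + gradφ z) ∧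
      QuasiTwoScale.WeakTwoScaleVec Ω R (fun k => η (s k)) (fun k => uη (s k)) u₀ ∧
      QuasiTwoScale.WeakTwoScaleVec Ω R (fun k => η (s k)) (fun k => curlη (s k))
        (fun z => curlu z.1 + curlu₁ z) := by
  have : IsFiniteMeasure (volume.restrict Ω) :=
    isFiniteMeasure_restrict.2 hΩb.measure_lt_top.ne
  obtain ⟨s, v₀, c₀, hs, hv₀, hc₀, hv, hc⟩ := QuasiTwoScale.exists_subseq_weakTwoScaleVec hR hη hη0
    hΩ.measurableSet (fun j => (hu j).memLp) (fun j => (hu j).memLp_curl) hbdd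
  have hηs : Tendsto (fun k => η (s k)) atTop (𝓝 0) := hη0.comp hs.tendsto_atTop
  have hX : QuasiTwoScale.MemL2CurlRFree Ω R v₀ :=
    QuasiTwoScale.memL2CurlRFree_of_integral hΩ hv₀ fun ψ hψ k a ζ =>
      QuasiTwoScale.integral_cross_wave_eq_zero (fun k => hη (s k)) hηs (fun k => hu (s k))
        hv₀ hc₀ hv hc hψ k a ζ
  have hdot := QuasiTwoScale.ae_dotProduct_coeff_eq_zero hΩ hc₀ fun ψ hψ k ζ =>
    QuasiTwoScale.integral_wave_eq_zero (fun k => hη (s k)) hηs (fun k => hu (s k)) hc₀ hc hψ k ζ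
  have hmean := QuasiTwoScale.hasWeakCurl_integral (fun k => hu (s k)) hv₀ hc₀ hv hc
  refine ⟨s, v₀, _, _, _, _, _, _, hs, hX.memHcurlX hR hmean, hX.isGradRField hR,
    QuasiTwoScale.isCurlRField_of_dotProduct_coeff hR hc₀ hdot, Eventually.of_forall fun x => rfl,
    hmean, Eventually.of_forall fun z => ?_, hv, ?_⟩
  · simp only [add_sub_cancel]
  · simpa only [add_sub_cancel] using hc
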